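/- Let $K$ be a field and let $e,m,n$ be integers with $e\ge 10$ and $2\le m<n\le e-2$. Put $J=\{0,1,\dots,e-1\}\setminus\{m,n\}$, let $A=K[X_i : i\in J]$, let $\phi:A\to K[t]$ be the $K$-algebra homomorphism with $\phi(X_i)=t^{e+i}$, and let $I_{e,m,n}=\ker\phi$ (the defining ideal of the semigroup ring of $\langle\{e,e+1,\dots,2e-1\}\setminus\{e+m,e+n\}\rangle$). For integers $j,k$ consider the binomials $$\begin{aligned} f_1(j,k)&=X_{k+1}X_j-X_kX_{j+1}, & f_2(j)&=X_jX_0^2-X_{j+1}X_{e-1},\\ f_3(j)&=X_{m+2}X_{j-4}-X_{m-2}X_j, & f_4(j)&=X_{m-1}X_{j+2}-X_{m+1}X_j,\\ f_5(j)&=X_{n-1}X_{j+2}-X_{n+1}X_j, & f_6(j,k)&=X_0X_jX_{m-1}-X_{m+2+k}X_{e-3+j-k},\\ f_7(j,k)&=X_0X_{1+k}X_{n-1-k}-X_{n+2-j}X_{e-2+j}, & f_8(j)&=X_0^2X_{n-1}-X_{n+2-j}X_{e-3+j},\\ f_9&=X_{m-1}^2-X_{m-4}X_{m+2}, & f_{10}&=X_{m+2}X_{e-4}-X_{m-1}X_{e-1},\\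 f_{11}&=X_{m+1}X_{n-2}-X_{m-2}X_{n+1}, & f_{12}&=X_{m+2}X_{n-1}-X_{m-1}X_{n+2},\\ f_{13,a}&=X_1^3-X_5X_{e-2}, & f_{13,b}&=X_1^3-X_4X_{e-1},\\ f_{14}&=X_1^2X_{n-1}-X_{n+2}X_{e-1}, & f_{15}(j)&=X_2^2X_{j+1}-X_{6+j}X_{e-1}. \end{aligned}$$ Write $[a,b]$ for the set of integers $i$ with $a\le i\le b$ (empty if $a>b$). For a set $T$ of integers let $f_1[T]=\{f_1(j,k): j,k\in T,\ k<j\}$, and for $i\in\{2,3,4,5\}$ let $f_i[T]=\{f_i(j): j\in T\}$. Define a set $\mathcal I_{e,m,n}$ of binomials as follows. In every case it contains $f_1[D]$ and $f_2[D]$, where $D=[0,e-2]\setminus\{m-1,m,n-1,n\}$. Besides these it consists of exactly the following elements. 1. If $4\le m$ and $n=m+1$: - $m\le e-6$: $f_3\big[[4,m-1]\cup[m+6,e-1]\big]$ and $f_6(0,0),f_6(1,0),f_7(0,1),f_9,f_{10}$; - $m=e-5$: $f_3\big[[4,e-6]\big]$ and $f_6(0,0),f_6(1,0),f_7(0,1),f_9$;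 - $m=e-4$: $f_3\big[[4,e-5]\big]$ and $f_6(1,0),f_7(0,1),f_9$; - $m=e-3$: $f_3\big[[4,e-4]\big]$ and $f_9,f_7(1,1)$. 2. If $3\le m$ and $n=m+2$: - $m\le e-5$: $f_4\big[[0,e-3]\setminus\{m-2,m-1,m,m+2\}\big]$ and $f_5\big[[0,e-3]\setminus[m-2,m+2]\big]$; together with $f_6(0,-1),f_6(1,-1),f_7(0,0)$ and $f_8(0)$ if $m\le e-6$, or $f_6(0,-1),f_6(1,-1),f_7(0,0)$ and $f_8(1)$ if $m=e-5$; - $m=e-4$: $f_4\big[[0,e-3]\setminus[m-2,m]\big]$, $f_5\big[[0,e-3]\setminus[m-2,m+1]\big]$ and $f_6(1,-1),f_7(1,0)$. 3. If $3\le m<n-2$: - $n\le e-3$: $f_4\big[[0,e-3]\setminus\{m-2,m-1,m,n-2,n\}\big]$ and $f_5\big[[0,m-3]\cup[m+1,n-3]\cup[n+1,e-3]\big]$; together with $f_6(0,0),f_6(1,0),f_7(0,0),f_8(0),f_{11},f_{12}$ if $n\le e-4$, or $f_6(0,-1),f_6(1,-1),f_7(0,0),f_8(1),f_{11},f_{12}$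 if $n=e-3$; - $n=e-2$: $f_4\big[[0,e-3]\setminus\{m-2,m-1,m,n-2\}\big]$, $f_5\big[[0,e-3]\setminus\{m-2,m-1,m,n-2,n-1\}\big]$ and $f_6(0,0),f_6(1,-1),f_7(1,0),f_{11}$. 4. If $m=2$ and $n\in\{4,5\}$: - $n=4$: $f_4\big[[3,e-3]\setminus\{4\}\big]$, $f_5\big[[5,e-3]\big]$ and $f_6(0,-1),f_6(1,-1),f_7(0,0),f_8(0),f_{13,a},f_{14}$; - $n=5$: $f_4\big[[4,e-3]\setminus\{5\}\big]$, $f_5\big[[6,e-3]\big]$ and $f_6(0,0),f_6(1,0),f_7(0,0),f_8(0),f_{11},f_{12},f_{13,b},f_{14}$. 5. If $m=2$ and $n\ge 6$: - $n\le e-3$: $f_4\big[[0,e-3]\setminus\{0,1,2,n-2,n\}\big]$ and $f_5\big[[0,e-3]\setminus\{0,1,2,n-2,n-1,n\}\big]$; together with $f_6(0,0),f_6(1,0),f_7(0,0),f_8(0),f_{11},f_{12},f_{13,b}$ if $n\le e-4$, or $f_6(0,1),f_6(1,0),f_7(1,0),f_8(1),f_{11},f_{12},f_{13,b}$ if $n=e-3$;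 - $n=e-2$: $f_4\big[[0,e-3]\setminus\{0,1,2,n-2\}\big]$, $f_5\big[[0,e-3]\setminus\{0,1,2,n-2,n-1\}\big]$ and $f_6(0,0),f_6(1,1),f_7(1,0),f_{11},f_{13,b}$. 6. If $(m,n)\in\{(2,3),(3,4)\}$: - $(m,n)=(2,3)$: $f_3\big[[8,e-1]\big]$ and $f_6(0,1),f_6(1,1),f_{10},f_{13,b}$; - $(m,n)=(3,4)$: $f_3\big[[9,e-1]\big]$ and $f_6(0,1),f_6(1,1),f_7(0,1),f_{10},f_{15}(0),f_{15}(1)$. All variables occurring in these binomials belong to $A$. **Theorem.** $\mathcal I_{e,m,n}$ is a minimal generating set of $I_{e,m,n}$: it generates $I_{e,m,n}$, no proper subset of it generates $I_{e,m,n}$, and no generating set of $I_{e,m,n}$ has fewer elements. The number of its elements is $$|\mathcal I_{e,m,n}|=\begin{cases}\binom{e-2}{2}, & (m,n)\in\{(2,4),(2,5),(3,4)\},\\[2pt] \binom{e-2}{2}-1, & m=2 \text{ and } (n=3\text{ or } n\ge 6),\\[2pt] \binom{e-2}{2}-2, & \text{otherwise.}\end{cases}$$ -/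

import Mathlib

noncomputable section

namespace SallyType

/-- The index set `[0, e-1] \ {m, n}` of the variables. -/
def J (e m n : ℕ) : Finset ℕ := Finset.range e \ {m, n}

/-- The polynomial ring `K[X_i : i ∈ J e m n]` in `e - 2` variables. -/
abbrev A (K : Type*) [Field K] (e m n : ℕ) : Type _ := MvPolynomial (J e m n) K

/-- The `K`-algebra homomorphism `X_i ↦ t^(e+i)`, with values in `K[t]`. -/
def phi (K : Type*) [Field K] (e m n : ℕ) : A K e m n →ₐ[K] Polynomial K :=
  MvPolynomial.aeval fun i : J e m n => (Polynomial.X : Polynomial K) ^ (e + (i : ℕ))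

/-- The defining ideal of the semigroup ring of
`⟨{e, e+1, …, 2e-1} \ {e+m, e+n}⟩`: the kernel of `phi`. -/
def definingIdeal (K : Type*) [Field K] (e m n : ℕ) : Ideal (A K e m n) :=
  RingHom.ker (phi K e m n)

/-- The variable `X_i`, indexed by an integer so that index arithmetic such as `m - 4` or
`m + 2 + k` with `k = -1` is not truncated. The value `0` for an index outside `J e m n` is a
placeholder. -/
def x (K : Type*) [Field K] (e m n : ℕ) (i : ℤ) : A K e m n :=
  if h : 0 ≤ i ∧ i.toNat ∈ J e m n then MvPolynomial.X ⟨i.toNat, h.2⟩ else 0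

section Binomials

variable (K : Type*) [Field K] (e m n : ℕ)

local notation "X" => x K e m n

def f1 (j k : ℤ) : A K e m n := X (k + 1) * X j - X k * X (j + 1)

def f2 (j : ℤ) : A K e m n := X j * X 0 ^ 2 - X (j + 1) * X (e - 1)

def f3 (j : ℤ) : A K e m n := X (m + 2) * X (j - 4) - X (m - 2) * X j

def f4 (j : ℤ) : A K e m n := X (m - 1) * X (j + 2) - X (m + 1) * X j

def f5 (j : ℤ) : A K e m n := X (n - 1) * X (j + 2) - X (n + 1) * X j

def f6 (j k : ℤ) : A K e m n := X 0 * X j * X (m - 1) - X (m + 2 + k) * X (e - 3 + j - k)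

def f7 (j k : ℤ) : A K e m n :=
  X 0 * X (1 + k) * X (n - 1 - k) - X (n + 2 - j) * X (e - 2 + j)

def f8 (j : ℤ) : A K e m n := X 0 ^ 2 * X (n - 1) - X (n + 2 - j) * X (e - 3 + j)

def f9 : A K e m n := X (m - 1) ^ 2 - X (m - 4) * X (m + 2)

def f10 : A K e m n := X (m + 2) * X (e - 4) - X (m - 1) * X (e - 1)

def f11 : A K e m n := X (m + 1) * X (n - 2) - X (m - 2) * X (n + 1)

def f12 : A K e m n := X (m + 2) * X (n - 1) - X (m - 1) * X (n + 2)

def f13a : A K e m n := X 1 ^ 3 - X 5 * X (e - 2)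

def f13b : A K e m n := X 1 ^ 3 - X 4 * X (e - 1)

def f14 : A K e m n := X 1 ^ 2 * X (n - 1) - X (n + 2) * X (e - 1)

def f15 (j : ℤ) : A K e m n := X 2 ^ 2 * X (j + 1) - X (6 + j) * X (e - 1)

/-- The binomials `f1 j k` with `k < j` both in `s`. -/
def F1 (s : Set ℤ) : Set (A K e m n) := {p | ∃ j ∈ s, ∃ k ∈ s, k < j ∧ p = f1 K e m n j k}

/-- The binomials `f2 j` with `j` in `s`. -/
def F2 (s : Set ℤ) : Set (A K e m n) := f2 K e m n '' s

/-- The binomials `f3 j` with `j` in `s`. -/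
def F3 (s : Set ℤ) : Set (A K e m n) := f3 K e m n '' s

/-- The binomials `f4 j` with `j` in `s`. -/
def F4 (s : Set ℤ) : Set (A K e m n) := f4 K e m n '' s

/-- The binomials `f5 j` with `j` in `s`. -/
def F5 (s : Set ℤ) : Set (A K e m n) := f5 K e m n '' s

end Binomials

section Lists

open Set

variable (K : Type*) [Field K] (e m n : ℕ)

local notation "f₁" => F1 K e m n
local notation "f₂" => F2 K e m n
local notation "f₃" => F3 K e m n
local notation "f₄" => F4 K e m n
local notation "f₅" => F5 K e m n
local notation "f₆" => f6 K e m n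
local notation "f₇" => f7 K e m n
local notation "f₈" => f8 K e m n
local notation "f₉" => f9 K e m n
local notation "f₁₀" => f10 K e m n
local notation "f₁₁" => f11 K e m n
local notation "f₁₂" => f12 K e m n
local notation "f₁₃a" => f13a K e m n
local notation "f₁₃b" => f13b K e m n
local notation "f₁₄" => f14 K e m n
local notation "f₁₅" => f15 K e m n

/-- The list for `4 ≤ m < n = m + 1 ≤ e - 2`. -/
def gensA : Set (A K e m n) :=
  f₁ (Icc 0 (e - 2) \ Icc (m - 1) (m + 1)) ∪
  f₂ (Icc 0 (e - 2) \ Icc (m - 1) (m + 1)) ∪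
  if m + 6 ≤ e then
    f₃ (Icc 4 (m - 1) ∪ Icc (m + 6) (e - 1)) ∪ {f₆ 0 0, f₆ 1 0, f₇ 0 1, f₉, f₁₀}
  else if m + 5 = e then
    f₃ (Icc 4 (e - 6)) ∪ {f₆ 0 0, f₆ 1 0, f₇ 0 1, f₉}
  else if m + 4 = e then
    f₃ (Icc 4 (e - 5)) ∪ {f₆ 1 0, f₇ 0 1, f₉}
  else
    f₃ (Icc 4 (e - 4)) ∪ {f₉, f₇ 1 1}

/-- The list for `3 ≤ m < n = m + 2 ≤ e - 2`. -/
def gensB : Set (A K e m n) :=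
  f₁ (Icc 0 (e - 2) \ Icc (m - 1) (m + 2)) ∪
  f₂ (Icc 0 (e - 2) \ Icc (m - 1) (m + 2)) ∪
  (if m + 5 ≤ e then
    f₄ (Icc 0 (e - 3) \ {(m - 2 : ℤ), (m - 1 : ℤ), (m : ℤ), (m + 2 : ℤ)}) ∪
    f₅ (Icc 0 (e - 3) \ Icc (m - 2) (m + 2))
  else
    f₄ (Icc 0 (e - 3) \ Icc (m - 2) m) ∪
    f₅ (Icc 0 (e - 3) \ Icc (m - 2) (m + 1))) ∪
  if m + 6 ≤ e then
    {f₆ 0 (-1), f₆ 1 (-1), f₇ 0 0, f₈ 0}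
  else if m + 5 = e then
    {f₆ 0 (-1), f₆ 1 (-1), f₇ 0 0, f₈ 1}
  else
    {f₆ 1 (-1), f₇ 1 0}

/-- The list for `3 ≤ m < n - 2 ≤ e - 4`. -/
def gensC : Set (A K e m n) :=
  f₁ (Icc 0 (e - 2) \ {(m - 1 : ℤ), (m : ℤ), (n - 1 : ℤ), (n : ℤ)}) ∪
  f₂ (Icc 0 (e - 2) \ {(m - 1 : ℤ), (m : ℤ), (n - 1 : ℤ), (n : ℤ)}) ∪
  (if n + 3 ≤ e then
    f₄ (Icc 0 (e - 3) \ {(m - 2 : ℤ), (m - 1 : ℤ), (m : ℤ), (n - 2 : ℤ), (n : ℤ)}) ∪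
    f₅ (Icc 0 (m - 3) ∪ Icc (m + 1) (n - 3) ∪ Icc (n + 1) (e - 3))
  else
    f₄ (Icc 0 (e - 3) \ {(m - 2 : ℤ), (m - 1 : ℤ), (m : ℤ), (n - 2 : ℤ)}) ∪
    f₅ (Icc 0 (e - 3) \ {(m - 2 : ℤ), (m - 1 : ℤ), (m : ℤ), (n - 2 : ℤ), (n - 1 : ℤ)})) ∪
  if n + 4 ≤ e then
    {f₆ 0 0, f₆ 1 0, f₇ 0 0, f₈ 0, f₁₁, f₁₂}
  else if n + 3 = e then
    {f₆ 0 (-1), f₆ 1 (-1), f₇ 0 0, f₈ 1, f₁₁, f₁₂}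
  else
    {f₆ 0 0, f₆ 1 (-1), f₇ 1 0, f₁₁}

/-- The list for `m = 2`, `n ∈ {4, 5}`. -/
def gensD : Set (A K e m n) :=
  f₁ (Icc 0 (e - 2) \ {(1 : ℤ), (2 : ℤ), (n - 1 : ℤ), (n : ℤ)}) ∪
  f₂ (Icc 0 (e - 2) \ {(1 : ℤ), (2 : ℤ), (n - 1 : ℤ), (n : ℤ)}) ∪
  if n = 4 then
    f₄ (Icc 3 (e - 3) \ {(4 : ℤ)}) ∪ f₅ (Icc 5 (e - 3)) ∪
    {f₆ 0 (-1), f₆ 1 (-1), f₇ 0 0, f₈ 0, f₁₃a, f₁₄}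
  else
    f₄ (Icc 4 (e - 3) \ {(5 : ℤ)}) ∪ f₅ (Icc 6 (e - 3)) ∪
    {f₆ 0 0, f₆ 1 0, f₇ 0 0, f₈ 0, f₁₁, f₁₂, f₁₃b, f₁₄}

/-- The list for `m = 2`, `6 ≤ n ≤ e - 2`. -/
def gensE : Set (A K e m n) :=
  f₁ (Icc 0 (e - 2) \ {(1 : ℤ), (2 : ℤ), (n - 1 : ℤ), (n : ℤ)}) ∪
  f₂ (Icc 0 (e - 2) \ {(1 : ℤ), (2 : ℤ), (n - 1 : ℤ), (n : ℤ)}) ∪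
  (if n + 3 ≤ e then
    f₄ (Icc 0 (e - 3) \ {(0 : ℤ), (1 : ℤ), (2 : ℤ), (n - 2 : ℤ), (n : ℤ)}) ∪
    f₅ (Icc 0 (e - 3) \ {(0 : ℤ), (1 : ℤ), (2 : ℤ), (n - 2 : ℤ), (n - 1 : ℤ), (n : ℤ)})
  else
    f₄ (Icc 0 (e - 3) \ {(0 : ℤ), (1 : ℤ), (2 : ℤ), (n - 2 : ℤ)}) ∪
    f₅ (Icc 0 (e - 3) \ {(0 : ℤ), (1 : ℤ), (2 : ℤ), (n - 2 : ℤ), (n - 1 : ℤ)})) ∪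
  if n + 4 ≤ e then
    {f₆ 0 0, f₆ 1 0, f₇ 0 0, f₈ 0, f₁₁, f₁₂, f₁₃b}
  else if n + 3 = e then
    {f₆ 0 1, f₆ 1 0, f₇ 1 0, f₈ 1, f₁₁, f₁₂, f₁₃b}
  else
    {f₆ 0 0, f₆ 1 1, f₇ 1 0, f₁₁, f₁₃b}

/-- The list for `(m, n) ∈ {(2, 3), (3, 4)}`. -/
def gensF : Set (A K e m n) :=
  f₁ (Icc 0 (e - 2) \ {(m - 1 : ℤ), (m : ℤ), (n : ℤ)}) ∪
  f₂ (Icc 0 (e - 2) \ {(m - 1 : ℤ), (m : ℤ), (n : ℤ)}) ∪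
  if m = 2 then
    f₃ (Icc 8 (e - 1)) ∪ {f₆ 0 1, f₆ 1 1, f₁₀, f₁₃b}
  else
    f₃ (Icc 9 (e - 1)) ∪ {f₆ 0 1, f₆ 1 1, f₇ 0 1, f₁₀, f₁₅ 0, f₁₅ 1}

/-- The list of binomials attached to `(e, m, n)`, for `2 ≤ m < n ≤ e - 2`. -/
def gens : Set (A K e m n) :=
  if (m = 2 ∧ n = 3) ∨ (m = 3 ∧ n = 4) then gensF K e m n
  else if m = 2 ∧ (n = 4 ∨ n = 5) then gensD K e m n
  else if m = 2 then gensE K e m n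
  else if n = m + 1 then gensA K e m n
  else if n = m + 2 then gensB K e m n
  else gensC K e m n

end Lists

end SallyType

end

namespace SallyType

/-! Give `X_i` the weight `e + i`, so that `phi` sends a monomial of weight `w` to `t^w`. The
theorem is a generation statement together with a lower bound that the list attains.

Generation. Take any commutative ring with elements `y i` satisfying `Rels`. The gaps `m` and `n`
cut the indices into intervals. Sliding inside intervals and jumping over the gaps shows that a
product of two variables depends only on its index sum (`Rels.pair`). Hence `y a * y b` is a
multiple of `y 0` unless `a + b` is `m` or `n`, with one exception for `(m, n) = (2, 3)`
(`Rels.down_pair`). So every monomial is either `y 0` times a monomial or one of a few normal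
monomials, whose weights form the Apéry set of the semigroup with respect to `e`
(`Rels.down_or_normal`). By induction on the weight, monomials of equal weight agree
(`Rels.mon_unique`), and therefore the quotient by the listed binomials factors through `phi`
(`definingIdeal_le_span`).

Lower bound. An element of the kernel has coefficient zero at a monomial that is alone in its
weight. If all proper divisors of the monomials in a finite set `M` are of this kind, then
multiplying an element of the kernel by `g` scales its coefficients on `M` by the constant term of
`g`. So the coefficient vectors of a generating set span those of the whole ideal, a space of
dimension at least `|M| - |W|` for a suitable set `W` of weights (`card_le_encard_of_span_eq`). All
quadratic monomials and the `e` weights from `2e` to `3e - 1` give `C(e-1,2) - e = C(e-2,2) - 2`; at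
most two cubic monomials, or one superfluous weight, account for the special cases. The list has at
most that many elements, so the bound is attained and minimality follows. -/

/-- The integer `i` is the index of a variable. -/
def IsIdx (e m n : ℕ) (i : ℤ) : Prop := 0 ≤ i ∧ i < e ∧ i ≠ m ∧ i ≠ n

/-- The relations between the variables that the lists of binomials impose, in a form that is
uniform in `m` and `n`. -/
structure Rels {B : Type*} [CommRing B] (e m n : ℕ) (y : ℤ → B) : Prop where
  shift : ∀ j k, IsIdx e m n j → IsIdx e m n (j + 1) → IsIdx e m n k → IsIdx e m n (k + 1) →
    y (k + 1) * y j = y k * y (j + 1)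
  jump_four : n = m + 1 → ∀ j : ℤ, (4 ≤ j ∧ j ≤ m - 1 ∨ m + 6 ≤ j ∧ j ≤ e - 1) →
    y (m + 2) * y (j - 4) = y (m - 2) * y j
  jump_low : n = m + 1 → 4 ≤ m → y (m - 1) * y (m - 1) = y (m - 4) * y (m + 2)
  jump_high : n = m + 1 → m + 6 ≤ e → y (m + 2) * y (e - 4) = y (m - 1) * y (e - 1)
  jump_m : m + 2 ≤ n → ∀ j, IsIdx e m n j → IsIdx e m n (j + 2) → j ≠ m - 1 →
    y (m - 1) * y (j + 2) = y (m + 1) * y j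
  jump_n : m + 2 ≤ n → ∀ j, IsIdx e m n j → IsIdx e m n (j + 2) → j ≠ m - 1 → j ≠ n - 1 →
    y (n - 1) * y (j + 2) = y (n + 1) * y j
  jump_both_low : m + 3 ≤ n → y (m + 1) * y (n - 2) = y (m - 2) * y (n + 1)
  jump_both_high : m + 3 ≤ n → n + 3 ≤ e → y (m + 2) * y (n - 1) = y (m - 1) * y (n + 2)
  descend : ∀ r : ℤ, 0 ≤ r → ¬(m = 2 ∧ n = 3 ∧ r = 3) →
    (∃ a b, IsIdx e m n a ∧ IsIdx e m n b ∧ a + b = e + r) →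
    ∃ a b c d, IsIdx e m n a ∧ IsIdx e m n b ∧ IsIdx e m n c ∧ IsIdx e m n d ∧
      a + b = e + r ∧ c + d = r ∧ y 0 * y c * y d = y a * y b
  cube_one : m = 2 → ∃ a b, IsIdx e m n a ∧ IsIdx e m n b ∧ a + b = e + 3 ∧
    y 1 * y 1 * y 1 = y a * y b
  sq_one_mul : m = 2 → n = 4 ∨ n = 5 → y 1 * y 1 * y (n - 1) = y (n + 2) * y (e - 1)
  sq_two_mul_one : m = 3 → n = 4 → y 2 * y 2 * y 1 = y 6 * y (e - 1)
  cube_two : m = 3 → n = 4 → y 2 * y 2 * y 2 = y 7 * y (e - 1)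

/-! ### Products of two variables -/

section Pairs

variable {B : Type*} [CommRing B] {e m n : ℕ} {y : ℤ → B}

/-- Each use of `shift` transfers one unit of index between the factors. Both factors stay in
gap-free intervals, so every intermediate product exists. -/
theorem Rels.rect (h : Rels e m n y) (p p' q q' : ℤ)
    (hp : ∀ i, p ≤ i → i ≤ p' → IsIdx e m n i) (hq : ∀ i, q ≤ i → i ≤ q' → IsIdx e m n i)
    (k : ℕ) : ∀ a b : ℤ, p ≤ a → a + k ≤ p' → q ≤ b → b + k ≤ q' →
      y (a + k) * y b = y a * y (b + k) := by
  induction k with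
  | zero => intros; simp
  | succ k ih =>
    intro a b h1 h2 h3 h4
    push_cast at h2 h4 ⊢
    have e1 := h.shift b (a + k) (hq _ (by omega) (by omega)) (hq _ (by omega) (by omega))
      (hp _ (by omega) (by omega)) (hp _ (by omega) (by omega))
    have e2 := ih a (b + 1) (by omega) (by omega) (by omega) (by omega)
    rw [← add_assoc, ← add_assoc, e1, e2, add_right_comm]

theorem Rels.rect' (h : Rels e m n y) (p p' q q' : ℤ)
    (hp : ∀ i, p ≤ i → i ≤ p' → IsIdx e m n i) (hq : ∀ i, q ≤ i → i ≤ q' → IsIdx e m n i)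
    (a b c d : ℤ) (hab : a + b = c + d) (ha : p ≤ a ∧ a ≤ p') (hc : p ≤ c ∧ c ≤ p')
    (hb : q ≤ b ∧ b ≤ q') (hd : q ≤ d ∧ d ≤ q') : y a * y b = y c * y d := by
  rcases le_total a c with hac | hac
  · obtain ⟨k, rfl⟩ := Int.le.dest hac
    obtain rfl : b = d + k := by omega
    exact (h.rect p p' q q' hp hq k a d ha.1 hc.2 hd.1 hb.2).symm
  · obtain ⟨k, rfl⟩ := Int.le.dest hac
    obtain rfl : d = b + k := by omega
    exact h.rect p p' q q' hp hq k c b hc.1 ha.2 hb.1 hd.2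

/-- The comparisons with `m` and `n` place `a`, `c` in one block (low, middle or high) and `b`, `d`
in one block, and blocks have no gaps. -/
theorem Rels.same (h : Rels e m n y) {a b c d : ℤ} (ha : IsIdx e m n a)
    (hb : IsIdx e m n b) (hc : IsIdx e m n c) (hd : IsIdx e m n d) (hab : a + b = c + d)
    (hac : (a < m ↔ c < m) ∧ (a < n ↔ c < n)) (hbd : (b < m ↔ d < m) ∧ (b < n ↔ d < n)) :
    y a * y b = y c * y d := by
  unfold IsIdx at ha hb hc hd
  refine h.rect' (min a c) (max a c) (min b d) (max b d) ?_ ?_ a b c d hab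
    (by omega) (by omega) (by omega) (by omega)
  all_goals
    intro i h1 h2
    unfold IsIdx
    omega

/-- One factor crosses `m` while the other stays in its block. Slide the first factor to the edges
`m - 1` and `m + 1`: the partners `a + b - m + 1` and `a + b - m - 1` lie between `d` and `b`, hence
in their block. -/
theorem Rels.link_jump_m (h : Rels e m n y) (hmn : m + 2 ≤ n) {a b c d : ℤ}
    (ha : IsIdx e m n a) (hb : IsIdx e m n b) (hc : IsIdx e m n c) (hd : IsIdx e m n d)
    (hab : a + b = c + d) (ham : a < m) (hcm : m < c ∧ c < n)
    (hbd : (b < m ↔ d < m) ∧ (b < n ↔ d < n)) : y a * y b = y c * y d := by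
  unfold IsIdx at ha hb hc hd
  have e1 : y a * y b = y (m - 1) * y (a + b - m - 1 + 2) :=
    h.same (by unfold IsIdx; omega) (by unfold IsIdx; omega) (by unfold IsIdx; omega)
      (by unfold IsIdx; omega) (by omega) (by omega) (by omega)
  have e2 : y c * y d = y (m + 1) * y (a + b - m - 1) :=
    h.same (by unfold IsIdx; omega) (by unfold IsIdx; omega) (by unfold IsIdx; omega)
      (by unfold IsIdx; omega) (by omega) (by omega) (by omega)
  rw [e1, e2]
  exact h.jump_m hmn _ (by unfold IsIdx; omega) (by unfold IsIdx; omega) (by omega)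

theorem Rels.link_jump_n (h : Rels e m n y) (hmn : m + 2 ≤ n) {a b c d : ℤ}
    (ha : IsIdx e m n a) (hb : IsIdx e m n b) (hc : IsIdx e m n c) (hd : IsIdx e m n d)
    (hab : a + b = c + d) (ham : m < a ∧ a < n) (hcm : n < c)
    (hbd : (b < m ↔ d < m) ∧ (b < n ↔ d < n)) : y a * y b = y c * y d := by
  unfold IsIdx at ha hb hc hd
  have e1 : y a * y b = y (n - 1) * y (a + b - n - 1 + 2) :=
    h.same (by unfold IsIdx; omega) (by unfold IsIdx; omega) (by unfold IsIdx; omega)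
      (by unfold IsIdx; omega) (by omega) (by omega) (by omega)
  have e2 : y c * y d = y (n + 1) * y (a + b - n - 1) :=
    h.same (by unfold IsIdx; omega) (by unfold IsIdx; omega) (by unfold IsIdx; omega)
      (by unfold IsIdx; omega) (by omega) (by omega) (by omega)
  rw [e1, e2]
  exact h.jump_n hmn _ (by unfold IsIdx; omega) (by unfold IsIdx; omega) (by omega) (by omega)

theorem Rels.link_low_high_mid_mid (h : Rels e m n y) (hmn : m + 2 ≤ n) {a b c d : ℤ}
    (ha : IsIdx e m n a) (hb : IsIdx e m n b) (hc : IsIdx e m n c) (hd : IsIdx e m n d)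
    (hab : a + b = c + d) (ham : a < m) (hbn : n < b) (hcm : m < c ∧ c < n)
    (hdm : m < d ∧ d < n) : y a * y b = y c * y d := by
  unfold IsIdx at ha hb hc hd
  have key : ∀ c' d' a' b' : ℤ, y c' * y d' = y a' * y b' → 0 ≤ a' → a' < m → n < b' → b' < e →
      m < c' → c' < n → m < d' → d' < n → a' + b' = a + b → c' + d' = a + b →
      y a * y b = y c * y d := by
    intro c' d' a' b' he h1 h2 h3 h4 h5 h6 h7 h8 h9 h10
    rw [h.same (c := a') (d := b') (by unfold IsIdx; omega) (by unfold IsIdx; omega)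
      (by unfold IsIdx; omega) (by unfold IsIdx; omega) (by omega) (by omega) (by omega), ← he]
    exact h.same (by unfold IsIdx; omega) (by unfold IsIdx; omega) (by unfold IsIdx; omega)
      (by unfold IsIdx; omega) (by omega) (by omega) (by omega)
  -- Small sums pass through a low-middle product with factor `m - 1`, large sums through a
  -- middle-high product with factor `m + 1`.
  by_cases h1 : a + b ≤ m + n - 2
  · rw [mul_comm (y a), ← h.link_jump_n hmn (a := a + b - m + 1) (b := m - 1)
      (by unfold IsIdx; omega) (by unfold IsIdx; omega) hb ha (by omega) (by omega) (by omega)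
      (by omega), mul_comm]
    exact h.link_jump_m hmn (by unfold IsIdx; omega) (by unfold IsIdx; omega) hc hd
      (by omega) (by omega) (by omega) (by omega)
  by_cases h2 : m + n + 2 ≤ a + b
  · rw [h.link_jump_m hmn (c := m + 1) (d := a + b - m - 1) ha hb
      (by unfold IsIdx; omega) (by unfold IsIdx; omega) (by omega) (by omega) (by omega)
      (by omega), mul_comm, mul_comm (y c)]
    exact (h.link_jump_n hmn hd hc (by unfold IsIdx; omega) (by unfold IsIdx; omega)
      (by omega) (by omega) (by omega) (by omega)).symm
  -- For the sums `m + n - 1` and `m + n + 1` the partner of `m - 1`, respectively `m + 1`, would be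
  -- the missing index `n`. This is why `jump_both_low` and `jump_both_high` are needed.
  obtain h3 | h3 | h3 : a + b = m + n - 1 ∨ a + b = m + n ∨ a + b = m + n + 1 := by omega
  · exact key _ _ _ _ (h.jump_both_low (by omega)) (by omega) (by omega) (by omega) (by omega)
      (by omega) (by omega) (by omega) (by omega) (by omega) (by omega)
  · have := h.jump_m hmn (n - 1) (by unfold IsIdx; omega) (by unfold IsIdx; omega) (by omega)
    exact key _ _ _ _ this.symm (by omega) (by omega) (by omega) (by omega)
      (by omega) (by omega) (by omega) (by omega) (by omega) (by omega)
  · exact key _ _ _ _ (h.jump_both_high (by omega) (by omega)) (by omega) (by omega) (by omega)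
      (by omega) (by omega) (by omega) (by omega) (by omega) (by omega) (by omega)

theorem Rels.link_low_low_low_high (h : Rels e m n y) (hmn : m + 2 ≤ n) {a b c d : ℤ}
    (ha : IsIdx e m n a) (hb : IsIdx e m n b) (hc : IsIdx e m n c) (hd : IsIdx e m n d)
    (hab : a + b = c + d) (ham : a < m) (hbn : b < m) (hcm : c < m)
    (hdm : n < d) : y a * y b = y c * y d := by
  unfold IsIdx at ha hb hc hd
  rw [h.link_jump_m hmn (c := m + 1) (d := a + b - m - 1) ha hb (by unfold IsIdx; omega)
    (by unfold IsIdx; omega) (by omega) ham (by omega) (by omega), mul_comm (y c)]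
  exact h.link_jump_n hmn (by unfold IsIdx; omega) (by unfold IsIdx; omega) hd hc (by omega)
    (by omega) (by omega) (by omega)

theorem Rels.link_low_high_high_high (h : Rels e m n y) (hmn : m + 2 ≤ n) {a b c d : ℤ}
    (ha : IsIdx e m n a) (hb : IsIdx e m n b) (hc : IsIdx e m n c) (hd : IsIdx e m n d)
    (hab : a + b = c + d) (ham : a < m) (hbn : n < b) (hcm : n < c)
    (hdm : n < d) : y a * y b = y c * y d := by
  unfold IsIdx at ha hb hc hd
  rw [h.link_jump_m hmn (c := n - 1) (d := a + b - n + 1) ha hb (by unfold IsIdx; omega)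
    (by unfold IsIdx; omega) (by omega) ham (by omega) (by omega)]
  exact h.link_jump_n hmn (by unfold IsIdx; omega) (by unfold IsIdx; omega) hc hd (by omega)
    (by omega) (by omega) (by omega)

theorem Rels.pair_of_add_two_le (h : Rels e m n y) (hmn : m + 2 ≤ n) {a b c d : ℤ}
    (ha : IsIdx e m n a) (hb : IsIdx e m n b) (hc : IsIdx e m n c) (hd : IsIdx e m n d)
    (hab : a + b = c + d) (h1 : a ≤ b) (h2 : c ≤ d) (hac : c ≤ a) : y a * y b = y c * y d := by
  have ha' := ha
  have hb' := hb
  have hc' := hc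
  have hd' := hd
  unfold IsIdx at ha' hb' hc' hd'
  by_cases e0 : ((a < m ↔ c < m) ∧ (a < n ↔ c < n)) ∧ ((b < m ↔ d < m) ∧ (b < n ↔ d < n))
  · exact h.same ha hb hc hd hab e0.1 e0.2
  by_cases e1 : a < m
  · -- the smaller factors both lie below `m`
    by_cases e2 : b < m
    · by_cases e3 : d < n
      · rw [mul_comm (y c), mul_comm (y a)]
        exact h.link_jump_m hmn hb ha hd hc (by omega) (by omega) (by omega) (by omega)
      · exact h.link_low_low_low_high hmn ha hb hc hd hab e1 e2 (by omega) (by omega)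
    · rw [mul_comm (y c), mul_comm (y a)]
      exact h.link_jump_n hmn hb ha hd hc (by omega) (by omega) (by omega) (by omega)
  by_cases e2 : a < n
  · by_cases e3 : b < n
    · by_cases e4 : c < m
      · by_cases e5 : d < n
        · exact (h.link_jump_m hmn hc hd ha hb (by omega) (by omega) (by omega) (by omega)).symm
        · exact (h.link_low_high_mid_mid hmn hc hd ha hb (by omega) (by omega) (by omega)
            (by omega) (by omega)).symm
      · rw [mul_comm (y c), mul_comm (y a)]
        exact h.link_jump_n hmn hb ha hd hc (by omega) (by omega) (by omega) (by omega)
    · exact (h.link_jump_m hmn hc hd ha hb (by omega) (by omega) (by omega) (by omega)).symm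
  · by_cases e4 : c < m
    · exact (h.link_low_high_high_high hmn hc hd ha hb (by omega) (by omega) (by omega)
        (by omega) (by omega)).symm
    · exact (h.link_jump_n hmn hc hd ha hb (by omega) (by omega) (by omega) (by omega)).symm

/-- Only two blocks remain, and `jump_four` joins them by trading `m - 2` for `m + 2`. The partner
of `m - 2` is unavailable only for the largest sums: it would be `m` for `2m - 2` and `e` for `m + e
- 2`. There `jump_low` and `jump_high` take over. -/
theorem Rels.pair_of_eq_add_one (h : Rels e m n y) (hm : 2 ≤ m) (hmn : n = m + 1) {a b c d : ℤ}
    (ha : IsIdx e m n a) (hb : IsIdx e m n b) (hc : IsIdx e m n c) (hd : IsIdx e m n d)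
    (hab : a + b = c + d) (h1 : a ≤ b) (h2 : c ≤ d) (hac : c ≤ a) : y a * y b = y c * y d := by
  have ha' := ha
  have hb' := hb
  have hc' := hc
  have hd' := hd
  unfold IsIdx at ha' hb' hc' hd'
  by_cases e0 : ((a < m ↔ c < m) ∧ (a < n ↔ c < n)) ∧ ((b < m ↔ d < m) ∧ (b < n ↔ d < n))
  · exact h.same ha hb hc hd hab e0.1 e0.2
  have key : ∀ a' b' c' d' : ℤ, y a' * y b' = y c' * y d' →
      ((a < m ↔ a' < m) ∧ (a < n ↔ a' < n)) → ((b < m ↔ b' < m) ∧ (b < n ↔ b' < n)) →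
      ((c < m ↔ c' < m) ∧ (c < n ↔ c' < n)) → ((d < m ↔ d' < m) ∧ (d < n ↔ d' < n)) →
      IsIdx e m n a' → IsIdx e m n b' → IsIdx e m n c' → IsIdx e m n d' →
      a + b = a' + b' → a + b = c' + d' → y a * y b = y c * y d := by
    intro a' b' c' d' he i1 i2 i3 i4 v1 v2 v3 v4 s1 s2
    rw [h.same ha hb v1 v2 s1 i1 i2, he]
    exact h.same v3 v4 hc hd (by omega) (by omega) (by omega)
  by_cases e1 : a < m
  · by_cases e2 : a + b = 2 * m - 2
    · refine key _ _ _ _ (h.jump_low hmn (by omega)) ?_ ?_ ?_ ?_ ?_ ?_ ?_ ?_ ?_ ?_ <;>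
        first | omega | (unfold IsIdx; omega)
    · have := h.jump_four hmn (a + b - m + 2) (by omega)
      rw [mul_comm (y (m + 2))] at this
      refine key _ _ _ _ this.symm ?_ ?_ ?_ ?_ ?_ ?_ ?_ ?_ ?_ ?_ <;>
        first | omega | (unfold IsIdx; omega)
  · by_cases e2 : a + b = m + e - 2
    · refine key _ _ _ _ (h.jump_high hmn (by omega)) ?_ ?_ ?_ ?_ ?_ ?_ ?_ ?_ ?_ ?_ <;>
        first | omega | (unfold IsIdx; omega)
    · have := h.jump_four hmn (a + b - m + 2) (by omega)
      refine key _ _ _ _ this ?_ ?_ ?_ ?_ ?_ ?_ ?_ ?_ ?_ ?_ <;>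
        first | omega | (unfold IsIdx; omega)

/-- Products of two variables only depend on the sum of the indices. -/
theorem Rels.pair (h : Rels e m n y) (hm : 2 ≤ m) (hmn : m < n) {a b c d : ℤ}
    (ha : IsIdx e m n a) (hb : IsIdx e m n b) (hc : IsIdx e m n c) (hd : IsIdx e m n d)
    (hab : a + b = c + d) : y a * y b = y c * y d := by
  have ordered : ∀ a b c d : ℤ, IsIdx e m n a → IsIdx e m n b → IsIdx e m n c → IsIdx e m n d →
      a + b = c + d → a ≤ b → c ≤ d → c ≤ a → y a * y b = y c * y d := by
    intro a b c d ha hb hc hd hab h1 h2 h3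
    by_cases h4 : n = m + 1
    · exact h.pair_of_eq_add_one hm h4 ha hb hc hd hab h1 h2 h3
    · exact h.pair_of_add_two_le (by omega) ha hb hc hd hab h1 h2 h3
  have left : ∀ a b c d : ℤ, IsIdx e m n a → IsIdx e m n b → IsIdx e m n c → IsIdx e m n d →
      a + b = c + d → a ≤ b → c ≤ d → y a * y b = y c * y d := by
    intro a b c d ha hb hc hd hab h1 h2
    rcases le_total c a with h3 | h3
    · exact ordered a b c d ha hb hc hd hab h1 h2 h3
    · exact (ordered c d a b hc hd ha hb hab.symm h2 h1 h3).symm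
  rcases le_total a b with h1 | h1 <;> rcases le_total c d with h2 | h2
  · exact left a b c d ha hb hc hd hab h1 h2
  · rw [mul_comm (y c)]; exact left a b d c ha hb hd hc (by omega) h1 h2
  · rw [mul_comm (y a)]; exact left b a c d hb ha hc hd (by omega) h1 h2
  · rw [mul_comm (y a), mul_comm (y c)]; exact left b a d c hb ha hd hc (by omega) h1 h2

end Pairs

/-! ### Normal forms of monomials -/

section Monomials

variable {B : Type*} [CommRing B] {e m n : ℕ} {y : ℤ → B}

/-- `Mon e m n y w b` says that `b` is a monomial of weight `w` in the `y i`, where `y i` has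
weight `e + i`. -/
inductive Mon (e m n : ℕ) (y : ℤ → B) : ℤ → B → Prop
  | one : Mon e m n y 0 1
  | cons {i w : ℤ} {b : B} : IsIdx e m n i → Mon e m n y w b → Mon e m n y (w + (e + i)) (y i * b)

theorem Mon.mul {w w' : ℤ} {b b' : B} (h : Mon e m n y w b) (h' : Mon e m n y w' b') :
    Mon e m n y (w + w') (b * b') := by
  induction h with
  | one => simpa using h'
  | cons hi _ ih =>
    rw [mul_assoc, add_right_comm]
    exact ih.cons hi

theorem Mon.single {i : ℤ} (hi : IsIdx e m n i) : Mon e m n y (e + i) (y i) := by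
  simpa using Mon.one.cons (y := y) hi

theorem Mon.weight {w : ℤ} {b : B} (h : Mon e m n y w b) :
    w = 0 ∨ (∃ i, IsIdx e m n i ∧ w = e + i) ∨
      (∃ i j, IsIdx e m n i ∧ IsIdx e m n j ∧ w = 2 * e + i + j) ∨ 3 * e ≤ w := by
  induction h with
  | one => exact Or.inl rfl
  | cons hi _ ih =>
    rename_i i w b _
    obtain rfl | ⟨j, hj, rfl⟩ | ⟨j, k, hj, hk, rfl⟩ | h := ih
    · exact Or.inr (Or.inl ⟨i, hi, by ring⟩)
    · exact Or.inr (Or.inr (Or.inl ⟨i, j, hi, hj, by ring⟩))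
    · unfold IsIdx at *
      omega
    · unfold IsIdx at *
      omega

/-- The monomial `b` of weight `w` is divisible by `y 0`. -/
def Down (e m n : ℕ) (y : ℤ → B) (w : ℤ) (b : B) : Prop :=
  ∃ w' b', Mon e m n y w' b' ∧ w = e + w' ∧ b = y 0 * b'

theorem Down.mul {w w' : ℤ} {b b' : B} (h : Down e m n y w b) (h' : Mon e m n y w' b') :
    Down e m n y (w + w') (b * b') := by
  obtain ⟨v, c, hc, rfl, rfl⟩ := h
  exact ⟨v + w', c * b', hc.mul h', by ring, by ring⟩

/-- For `a + b < e` the product is `y 0 * y (a + b)`; otherwise `descend` treats one pair with this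
sum and `Rels.pair` carries the result over. The sum `e + 3` is excluded for `(2, 3)` because no two
indices add up to `3` there. -/
theorem Rels.down_pair (h : Rels e m n y) (hm : 2 ≤ m) (hmn : m < n) {a b w : ℤ}
    (ha : IsIdx e m n a) (hb : IsIdx e m n b) (h1 : a + b ≠ m) (h2 : a + b ≠ n)
    (h3 : ¬(m = 2 ∧ n = 3 ∧ a + b = e + 3)) (hw : w = 2 * e + a + b) :
    Down e m n y w (y a * y b) := by
  by_cases hs : a + b < e
  · have hs' : IsIdx e m n (a + b) := by unfold IsIdx at *; omega
    refine ⟨e + (a + b), y (a + b), .single hs', by omega, h.pair hm hmn ha hb ?_ hs' (by ring)⟩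
    unfold IsIdx at *; omega
  · obtain ⟨a', b', c, d, ha', hb', hc, hd, hs', hcd, he⟩ :=
      h.descend (a + b - e) (by omega) (by omega) ⟨a, b, ha, hb, by omega⟩
    refine ⟨_, y c * y d, (Mon.single hc).mul (.single hd), by omega, ?_⟩
    rw [h.pair hm hmn ha hb ha' hb' (by omega), ← he, mul_assoc]

/-- These cubics resist `Rels.down_pair`, since every pair of factors has a missing index as its
sum. Splitting a pair differently exposes a good pair; where no other splitting helps, the cubic
relations of `Rels` step in. -/
theorem Rels.down_sq_mul (h : Rels e m n y) (he : 10 ≤ e) (hm : 2 ≤ m) (hmn : m < n)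
    (hn : n + 2 ≤ e) (h23 : ¬(m = 2 ∧ n = 3)) {i k w : ℤ} (hi : IsIdx e m n i)
    (hk : IsIdx e m n k) (hi1 : 1 ≤ i) (hk1 : 1 ≤ k) (h1 : i + i = m ∨ i + i = n)
    (h2 : i + k = m ∨ i + k = n) (hw : w = 3 * e + 2 * i + k) :
    Down e m n y w (y i * y i * y k) := by
  -- replace `y i * y i` by `y p * y q` and then use the pair `p, k`
  have replace : ∀ p q : ℤ, IsIdx e m n p → IsIdx e m n q → p + q = i + i → p + k ≠ m →
      p + k ≠ n → Down e m n y w (y i * y i * y k) := by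
    intro p q hp hq hpq h3 h4
    rw [h.pair hm hmn hi hi hp hq hpq.symm, mul_right_comm]
    have := (h.down_pair hm hmn hp hk h3 h4 (by omega) rfl).mul (Mon.single (y := y) hq)
    convert this using 1
    omega
  have hi' := hi
  have hk' := hk
  unfold IsIdx at hi' hk'
  by_cases hi2 : i = 1
  · subst hi2
    obtain rfl : m = 2 := by omega
    obtain hk2 | hk2 : k = 1 ∨ k = n - 1 := by omega
    · subst hk2
      obtain ⟨a, b, ha, hb, hs, hab⟩ := h.cube_one rfl
      rw [hab]
      exact h.down_pair hm hmn ha hb (by omega) (by omega) (by omega) (by omega)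
    · subst hk2
      by_cases hn5 : n = 4 ∨ n = 5
      · rw [h.sq_one_mul rfl hn5]
        exact h.down_pair hm hmn (by unfold IsIdx; omega) (by unfold IsIdx; omega)
          (by omega) (by omega) (by omega) (by omega)
      -- For `n ≥ 6` there is room to write `1 + (n - 1) = 3 + (n - 3)`, and `1 + 3` is neither `m`
      -- nor `n`.
      · have h3 : IsIdx e 2 n 3 := by unfold IsIdx; omega
        have h4 : IsIdx e 2 n (n - 3) := by unfold IsIdx; omega
        rw [mul_assoc, h.pair hm hmn hi hk h3 h4 (by ring), ← mul_assoc]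
        have := (h.down_pair hm hmn hi h3 (by omega) (by omega) (by omega) rfl).mul
          (Mon.single (y := y) h4)
        convert this using 1
        omega
  · obtain h1 | h1 := h1
    · by_cases hki : k = i
      · exact replace 1 (m - 1) (by unfold IsIdx; omega) (by unfold IsIdx; omega) (by omega)
          (by omega) (by omega)
      · exact replace (m - 1) 1 (by unfold IsIdx; omega) (by unfold IsIdx; omega) (by omega)
          (by omega) (by omega)
    -- If `n = m + 1`, the splitting `1 + (n - 1)` uses the missing index `m`, so `2 + (n - 2)`
    -- replaces it. For `(3, 4)` that is `2 + 2` again, whence two extra cubic relations.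
    · by_cases hn1 : n = m + 1
      · by_cases h34 : m = 3
        · obtain rfl : i = 2 := by omega
          obtain rfl | rfl : k = 1 ∨ k = 2 := by omega
          · rw [h.sq_two_mul_one h34 (by omega)]
            exact h.down_pair hm hmn (by unfold IsIdx; omega) (by unfold IsIdx; omega)
              (by omega) (by omega) (by omega) (by omega)
          · rw [h.cube_two h34 (by omega)]
            exact h.down_pair hm hmn (by unfold IsIdx; omega) (by unfold IsIdx; omega)
              (by omega) (by omega) (by omega) (by omega)
        · by_cases hki : k = i
          · exact replace (n - 2) 2 (by unfold IsIdx; omega) (by unfold IsIdx; omega) (by omega)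
              (by omega) (by omega)
          · exact replace 2 (n - 2) (by unfold IsIdx; omega) (by unfold IsIdx; omega) (by omega)
              (by omega) (by omega)
      · by_cases hki : k = i
        · exact replace (n - 1) 1 (by unfold IsIdx; omega) (by unfold IsIdx; omega) (by omega)
            (by omega) (by omega)
        · exact replace 1 (n - 1) (by unfold IsIdx; omega) (by unfold IsIdx; omega) (by omega)
            (by omega) (by omega)

/-- If all three pair sums lie in `{m, n}`, two of them are equal by pigeonhole, so two of the
indices are equal and `Rels.down_sq_mul` applies. -/
theorem Rels.down_cubic (h : Rels e m n y) (he : 10 ≤ e) (hm : 2 ≤ m) (hmn : m < n)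
    (hn : n + 2 ≤ e) (h23 : ¬(m = 2 ∧ n = 3)) {i j k w : ℤ} (hi : IsIdx e m n i)
    (hj : IsIdx e m n j) (hk : IsIdx e m n k) (hi1 : 1 ≤ i) (hj1 : 1 ≤ j) (hk1 : 1 ≤ k)
    (hw : w = 3 * e + i + j + k) :
    Down e m n y w (y i * y j * y k) := by
  have via : ∀ a b c : ℤ, IsIdx e m n a → IsIdx e m n b → IsIdx e m n c → 1 ≤ a → 1 ≤ b →
      1 ≤ c → w = 3 * e + a + b + c → ¬(a + b = m ∨ a + b = n) →
      Down e m n y w (y a * y b * y c) := by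
    intro a b c ha hb hc _ _ _ hw h3
    have := (h.down_pair hm hmn ha hb (by omega) (by omega) (by omega) rfl).mul
      (Mon.single (y := y) hc)
    convert this using 1
    omega
  by_cases h1 : i + j = m ∨ i + j = n
  swap
  · exact via i j k hi hj hk hi1 hj1 hk1 hw h1
  by_cases h2 : i + k = m ∨ i + k = n
  swap
  · rw [mul_right_comm]
    exact via i k j hi hk hj hi1 hk1 hj1 (by omega) h2
  by_cases h3 : j + k = m ∨ j + k = n
  swap
  · rw [mul_rotate]
    exact via j k i hj hk hi hj1 hk1 hi1 (by omega) h3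
  obtain rfl | rfl | rfl : i = j ∨ i = k ∨ j = k := by omega
  · exact h.down_sq_mul he hm hmn hn h23 hi hk hi1 hk1 h1 h2 (by omega)
  · rw [mul_right_comm]
    exact h.down_sq_mul he hm hmn hn h23 hi hj hi1 hj1 h2 h1 (by omega)
  · rw [mul_rotate]
    exact h.down_sq_mul he hm hmn hn h23 hj hi hj1 hi1 h3 (by omega) (by omega)

/-- The monomials that represent the elements `w` of the semigroup with `w - e` not in it. -/
def Normal (e m n : ℕ) (y : ℤ → B) (w : ℤ) (b : B) : Prop :=
  (w = 0 ∧ b = 1) ∨ (∃ i, IsIdx e m n i ∧ 1 ≤ i ∧ w = e + i ∧ b = y i) ∨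
  (∃ i j, IsIdx e m n i ∧ IsIdx e m n j ∧ 1 ≤ i ∧ 1 ≤ j ∧ (i + j = m ∨ i + j = n) ∧
    w = 2 * e + i + j ∧ b = y i * y j) ∨
  (m = 2 ∧ n = 3 ∧ w = 3 * e + 3 ∧ b = y 1 * y 1 * y 1)

theorem Rels.cons_normal (h : Rels e m n y) (he : 10 ≤ e) (hm : 2 ≤ m) (hmn : m < n)
    (hn : n + 2 ≤ e) {k w : ℤ} {b : B} (hk : IsIdx e m n k) (hk1 : 1 ≤ k)
    (hb : Normal e m n y w b) :
    Down e m n y (w + (e + k)) (y k * b) ∨ Normal e m n y (w + (e + k)) (y k * b) := by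
  obtain ⟨rfl, rfl⟩ | ⟨i, hi, hi1, rfl, rfl⟩ | ⟨i, j, hi, hj, hi1, hj1, hij, rfl, rfl⟩ |
    ⟨rfl, rfl, rfl, rfl⟩ := hb
  · exact Or.inr (Or.inr (Or.inl ⟨k, hk, hk1, by ring, by ring⟩))
  · by_cases hs : k + i = m ∨ k + i = n
    · exact Or.inr (Or.inr (Or.inr (Or.inl ⟨k, i, hk, hi, hk1, hi1, hs, by ring, rfl⟩)))
    by_cases h23 : m = 2 ∧ n = 3 ∧ k + i = e + 3
    · obtain ⟨a, c, ha, hc, hs, hac⟩ := h.cube_one h23.1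
      refine Or.inr (Or.inr (Or.inr (Or.inr ⟨h23.1, h23.2.1, by omega, ?_⟩)))
      rw [hac]
      exact h.pair hm hmn hk hi ha hc (by omega)
    · exact Or.inl (h.down_pair hm hmn hk hi (by omega) (by omega) h23 (by ring))
  · by_cases h23 : m = 2 ∧ n = 3
    · obtain ⟨rfl, rfl⟩ := h23
      unfold IsIdx at hi hj
      obtain rfl : i = 1 := by omega
      obtain rfl : j = 1 := by omega
      by_cases hk2 : k = 1
      · subst hk2
        exact Or.inr (Or.inr (Or.inr (Or.inr ⟨rfl, rfl, by ring, by ring⟩)))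
      · left
        have h1 : IsIdx e 2 3 1 := by unfold IsIdx; omega
        unfold IsIdx at hk
        have := (h.down_pair hm hmn hk h1 (by omega) (by omega) (by omega) rfl).mul
          (Mon.single (y := y) h1)
        rw [← mul_assoc]
        convert this using 1
        ring
    · left
      rw [← mul_assoc]
      exact h.down_cubic he hm hmn hn h23 hk hi hj hk1 hi1 hj1 (by ring)
  · left
    have h1 : IsIdx e 2 3 1 := by unfold IsIdx; omega
    -- The fourth power of `y 1` becomes `y 1 * y 4 * y (e - 1)` by `cube_one`, and `1 + 4` is a
    -- good sum.
    by_cases hk2 : k = 1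
    · subst hk2
      have h4 : IsIdx e 2 3 4 := by unfold IsIdx; omega
      have h5 : IsIdx e 2 3 (e - 1) := by unfold IsIdx; omega
      obtain ⟨a, c, ha, hc, hs, hac⟩ := h.cube_one rfl
      have := (h.down_pair hm hmn h1 h4 (by omega) (by omega) (by omega) rfl).mul
        (Mon.single (y := y) h5)
      rw [hac, h.pair hm hmn ha hc h4 h5 (by omega), ← mul_assoc]
      convert this using 1
      ring
    · have hk' := hk
      unfold IsIdx at hk'
      have := (h.down_pair hm hmn hk h1 (by omega) (by omega) (by omega) rfl).mul
        ((Mon.single (y := y) h1).mul (.single h1))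
      convert this using 1 <;> ring

theorem Rels.down_or_normal (h : Rels e m n y) (he : 10 ≤ e) (hm : 2 ≤ m) (hmn : m < n)
    (hn : n + 2 ≤ e) {w : ℤ} {b : B} (hb : Mon e m n y w b) :
    Down e m n y w b ∨ Normal e m n y w b := by
  induction hb with
  | one => exact Or.inr (Or.inl ⟨rfl, rfl⟩)
  | cons hk hb ih =>
    rename_i k w b
    by_cases hk1 : 1 ≤ k
    · obtain hd | hd := ih
      · left
        rw [mul_comm]
        exact hd.mul (.single hk)
      · exact h.cons_normal he hm hmn hn hk hk1 hd
    · obtain rfl : k = 0 := by unfold IsIdx at hk; omega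
      exact Or.inl ⟨w, b, hb, by ring, rfl⟩

/-- Lowering the weight of a normal monomial by `e` never gives the weight of a monomial, so its
weight alone rules out a factor `y 0`. -/
theorem Normal.not_down (he : 10 ≤ e) (hm : 2 ≤ m) (hmn : m < n) (hn : n + 2 ≤ e)
    {w : ℤ} {b b' : B} (hb : Normal e m n y w b) (hb' : Down e m n y w b') : False := by
  obtain ⟨w', c, hc, rfl, -⟩ := hb'
  have := hc.weight
  unfold Normal IsIdx at *
  obtain hb | ⟨i, hi⟩ | ⟨i, j, hij⟩ | hb := hb <;>
    obtain h | ⟨i', hi'⟩ | ⟨i', j', hij'⟩ | h := this <;> omega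

theorem Rels.normal_unique (h : Rels e m n y) (he : 10 ≤ e) (hm : 2 ≤ m) (hmn : m < n)
    (hn : n + 2 ≤ e) {w : ℤ} {b b' : B} (hb : Normal e m n y w b) (hb' : Normal e m n y w b') :
    b = b' := by
  obtain ⟨hw, rfl⟩ | ⟨i, hi, hi1, hw, rfl⟩ | ⟨i, j, hi, hj, hi1, hj1, hij, hw, rfl⟩ |
    ⟨hm', hn', hw, rfl⟩ := hb <;>
  obtain ⟨hv, rfl⟩ | ⟨k, hk, hk1, hv, rfl⟩ | ⟨k, l, hk, hl, hk1, hl1, hkl, hv, rfl⟩ |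
    ⟨hm', hn', hv, rfl⟩ := hb' <;>
  first
  | rfl
  | (exfalso; omega)
  | (exfalso; unfold IsIdx at *; omega)
  | exact congrArg y (by omega)
  | exact h.pair hm hmn hi hj hk hl (by omega)

/-- Monomials of the same weight agree. -/
theorem Rels.mon_unique (h : Rels e m n y) (he : 10 ≤ e) (hm : 2 ≤ m) (hmn : m < n)
    (hn : n + 2 ≤ e) {w : ℤ} {b b' : B} (hb : Mon e m n y w b) (hb' : Mon e m n y w b') :
    b = b' := by
  obtain ⟨N, hN⟩ : ∃ N : ℕ, w < N := ⟨w.toNat + 1, by omega⟩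
  induction N generalizing w b b' with
  | zero =>
    have := hb.weight
    unfold IsIdx at this
    obtain h | ⟨i', hi'⟩ | ⟨i', j', hij'⟩ | h := this <;> omega
  | succ N ih =>
    obtain h1 | h1 := h.down_or_normal he hm hmn hn hb <;>
    obtain h2 | h2 := h.down_or_normal he hm hmn hn hb'
    -- Both cofactors of `y 0` have the same weight, smaller by `e`; no cancellation in `B` is used.
    · obtain ⟨v, c, hc, rfl, rfl⟩ := h1
      obtain ⟨v', c', hc', hv, rfl⟩ := h2
      obtain rfl : v = v' := by omega
      rw [ih hc hc' (by omega)]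
    · exact (h2.not_down he hm hmn hn h1).elim
    · exact (h1.not_down he hm hmn hn h2).elim
    · exact h.normal_unique he hm hmn hn h1 h2

end Monomials

/-! ### From the relations to the kernel of `phi` -/

section Generation

variable {K : Type*} [Field K] {e m n : ℕ}

theorem isIdx_natCast {i : ℕ} : IsIdx e m n i ↔ i ∈ J e m n := by
  unfold IsIdx J
  simp only [Finset.mem_sdiff, Finset.mem_range, Finset.mem_insert, Finset.mem_singleton]
  omega

theorem x_natCast (i : J e m n) : x K e m n ((i : ℕ) : ℤ) = MvPolynomial.X i := by
  unfold x
  rw [dif_pos ⟨by omega, by simp⟩]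
  rfl

theorem phi_x {i : ℤ} (hi : IsIdx e m n i) :
    phi K e m n (x K e m n i) = Polynomial.X ^ (e + i.toNat) := by
  lift i to ℕ using hi.1
  rw [isIdx_natCast] at hi
  rw [x_natCast ⟨i, hi⟩]
  simp [phi]

/-- The weight of a monomial, where `X_i` has weight `e + i`. -/
noncomputable def wt (e m n : ℕ) : (J e m n →₀ ℕ) →+ ℕ := Finsupp.weight fun i : J e m n => e + (i : ℕ)

theorem wt_single (i : J e m n) : wt e m n (Finsupp.single i 1) = e + i := by
  simp [wt, Finsupp.weight_apply]

theorem monomial_single_add (i : J e m n) (s : J e m n →₀ ℕ) :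
    MvPolynomial.monomial (Finsupp.single i 1 + s) (1 : K) =
      x K e m n (i : ℕ) * MvPolynomial.monomial s 1 := by
  rw [x_natCast, MvPolynomial.X, MvPolynomial.monomial_mul, one_mul]

theorem finsupp_induction {σ : Type*} {P : (σ →₀ ℕ) → Prop} (zero : P 0)
    (cons : ∀ i s, P s → P (Finsupp.single i 1 + s)) (s : σ →₀ ℕ) : P s := by
  classical
  induction h : s.degree generalizing s with
  | zero => rwa [(Finsupp.degree_eq_zero_iff s).1 h]
  | succ k ih =>
    have hs : s ≠ 0 := by rintro rfl; simp at h
    obtain ⟨i, hi⟩ := Finsupp.ne_iff.1 hs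
    have : Finsupp.single i 1 + (s - Finsupp.single i 1) = s :=
      add_tsub_cancel_of_le (Finsupp.single_le_iff.2 (Nat.one_le_iff_ne_zero.2 hi))
    rw [← this]
    refine cons _ _ (ih _ ?_)
    rw [← this, map_add, Finsupp.degree_single] at h
    omega

theorem phi_monomial (s : J e m n →₀ ℕ) :
    phi K e m n (MvPolynomial.monomial s 1) = Polynomial.X ^ wt e m n s := by
  induction s using finsupp_induction with
  | zero => simp
  | cons i s ih =>
    rw [monomial_single_add, map_mul, phi_x (isIdx_natCast.2 i.2), ih, map_add, wt_single,
      Int.toNat_natCast, ← pow_add]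

theorem mon_monomial {B : Type*} [CommRing B] (q : A K e m n →+* B) (s : J e m n →₀ ℕ) :
    Mon e m n (fun i => q (x K e m n i)) (wt e m n s) (q (MvPolynomial.monomial s 1)) := by
  induction s using finsupp_induction with
  | zero => simpa using Mon.one
  | cons i s ih =>
    rw [monomial_single_add, map_mul, map_add, wt_single, add_comm]
    push_cast
    exact ih.cons (isIdx_natCast.2 i.2)

/-- Send `t^w` to the class of a chosen monomial of weight `w`, or to the harmless value `0` if
there is none. By `Rels.mon_unique` the composite of `phi` with this linear map is the quotient map,
which therefore kills the kernel of `phi`. -/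
theorem definingIdeal_le_span (he : 10 ≤ e) (hm : 2 ≤ m) (hmn : m < n) (hn : n + 2 ≤ e)
    (G : Set (A K e m n))
    (h : Rels e m n fun i => Ideal.Quotient.mk (Ideal.span G) (x K e m n i)) :
    definingIdeal K e m n ≤ Ideal.span G := by
  classical
  set q := Ideal.Quotient.mkₐ K (Ideal.span G) with hq
  let R : ℕ → A K e m n ⧸ Ideal.span G := fun w =>
    if hw : ∃ s, wt e m n s = w then q (MvPolynomial.monomial hw.choose 1) else 0
  have hR : ((Polynomial.basisMonomials K).constr K R) ∘ₗ (phi K e m n).toLinearMap =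
      q.toLinearMap := by
    refine MvPolynomial.linearMap_ext fun s => LinearMap.ext_ring ?_
    have hw : ∃ s', wt e m n s' = wt e m n s := ⟨s, rfl⟩
    have hb := Module.Basis.constr_basis (Polynomial.basisMonomials K) K R (wt e m n s)
    rw [Polynomial.coe_basisMonomials] at hb
    simp only [LinearMap.comp_apply, AlgHom.toLinearMap_apply, phi_monomial]
    rw [← Polynomial.monomial_one_right_eq_X_pow, hb]
    simp only [R]
    rw [dif_pos hw]
    have h1 := mon_monomial (Ideal.Quotient.mk (Ideal.span G)) hw.choose
    rw [hw.choose_spec] at h1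
    exact h.mon_unique he hm hmn hn h1 (mon_monomial _ s)
  intro f hf
  have := LinearMap.congr_fun hR f
  rw [LinearMap.comp_apply, AlgHom.toLinearMap_apply, (RingHom.mem_ker).1 hf, map_zero] at this
  exact Ideal.Quotient.eq_zero_iff_mem.1 this.symm

end Generation

/-! ### Lower bound for generating sets by linear algebra -/

section LowerBound

variable {K : Type*} [Field K] {e m n : ℕ}

theorem phi_eq_sum (f : A K e m n) :
    phi K e m n f = ∑ s ∈ f.support, MvPolynomial.coeff s f • Polynomial.X ^ wt e m n s := by
  conv_lhs => rw [f.as_sum]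
  rw [map_sum]
  refine Finset.sum_congr rfl fun s _ => ?_
  rw [← phi_monomial, ← map_smul, MvPolynomial.smul_monomial, smul_eq_mul, mul_one]

/-- The monomial `s` is the only one of its weight. -/
def IsUnique (s : J e m n →₀ ℕ) : Prop := ∀ s', wt e m n s' = wt e m n s → s' = s

theorem IsUnique.of_add {s t : J e m n →₀ ℕ} (h : IsUnique (s + t)) : IsUnique t := by
  intro t' ht'
  exact add_left_cancel (h (s + t') (by rw [map_add, map_add, ht']))

theorem IsUnique.coeff_eq_zero {s : J e m n →₀ ℕ} (h : IsUnique s) {f : A K e m n}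
    (hf : f ∈ definingIdeal K e m n) : MvPolynomial.coeff s f = 0 := by
  have h1 := congrArg (fun p => Polynomial.coeff p (wt e m n s)) ((phi_eq_sum f).symm.trans hf)
  simp only [Polynomial.finsetSum_coeff, Polynomial.coeff_smul, Polynomial.coeff_X_pow,
    Polynomial.coeff_zero] at h1
  by_contra hs
  rw [Finset.sum_eq_single s] at h1
  · simp at h1
    exact hs h1
  · intro t _ hts
    rw [if_neg, smul_zero]
    exact fun hw => hts (h t hw.symm)
  · intro hs'
    exact absurd (MvPolynomial.notMem_support_iff.1 hs') hs

/-- In the convolution formula every term except that of `(0, u)` contains the coefficient of `f` at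
a proper divisor of `u`, which vanishes. -/
theorem coeff_mul_of_isUnique {u : J e m n →₀ ℕ}
    (hu : ∀ i s, u = Finsupp.single i 1 + s → IsUnique s) {f : A K e m n}
    (hf : f ∈ definingIdeal K e m n) (g : A K e m n) :
    MvPolynomial.coeff u (g * f) = MvPolynomial.coeff 0 g * MvPolynomial.coeff u f := by
  classical
  rw [MvPolynomial.coeff_mul]
  refine Finset.sum_eq_single (0, u) ?_ (by simp)
  rintro ⟨p, r⟩ hpr hne
  rw [Finset.HasAntidiagonal.mem_antidiagonal] at hpr
  have hr : IsUnique r := by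
    induction p using finsupp_induction with
    | zero => exact absurd (by rw [← hpr]; simp) hne
    | cons i p _ =>
      exact (hu i (p + r) (by rw [← hpr]; simp [add_assoc])).of_add
  simp only
  rw [hr.coeff_eq_zero hf, mul_zero]

/-- A vector on `M` comes from the ideal as soon as its entries sum to zero within each weight of
`W`: at other weights a monomial outside `M` balances the image under `phi`. These are at most `|W|`
linear conditions. -/
theorem card_le_encard_of_span_eq (M : Finset (J e m n →₀ ℕ)) (W : Finset ℕ)
    (hM : ∀ u ∈ M, ∀ i s, u = Finsupp.single i 1 + s → IsUnique s)
    (hW : ∀ u ∈ M, wt e m n u ∉ W → ∃ v ∉ M, wt e m n v = wt e m n u)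
    (T : Set (A K e m n)) (hT : Ideal.span T = definingIdeal K e m n) :
    ((M.card - W.card : ℕ) : ℕ∞) ≤ T.encard := by
  classical
  by_cases hfin : T.Finite
  swap
  · rw [Set.Infinite.encard_eq hfin]
    exact le_top
  have : Fintype T := hfin.fintype
  rw [← hfin.cast_ncard_eq, Nat.cast_le]
  let coeffs : A K e m n →ₗ[K] (M → K) :=
    LinearMap.pi fun u => MvPolynomial.lcoeff K (u : J e m n →₀ ℕ)
  let sums : (M → K) →ₗ[K] (W → K) :=
    LinearMap.pi fun w => ∑ u : M, if wt e m n u = w then LinearMap.proj u else 0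
  have image_le : ∀ f ∈ definingIdeal K e m n, coeffs f ∈ Submodule.span K (coeffs '' T) := by
    intro f hf
    rw [← hT] at hf
    refine Submodule.span_induction (p := fun f _ => coeffs f ∈ Submodule.span K (coeffs '' T))
      ?_ ?_ ?_ ?_ hf
    · exact fun f hf => Submodule.subset_span ⟨f, hf, rfl⟩
    · simp
    · intro f g _ _ hf hg
      rw [map_add]
      exact add_mem hf hg
    · intro g f hf hf'
      rw [smul_eq_mul]
      have : coeffs (g * f) = MvPolynomial.coeff 0 g • coeffs f := by
        ext u
        exact coeff_mul_of_isUnique (hM u u.2) (hT ▸ hf) g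
      rw [this]
      exact Submodule.smul_mem _ _ hf'
  have ker_le : LinearMap.ker sums ≤ Submodule.span K (coeffs '' T) := by
    intro c hc
    choose! v hv hv' using hW
    let lift : M → A K e m n := fun u => MvPolynomial.monomial (u : J e m n →₀ ℕ) (1 : K) -
      if wt e m n u ∈ W then 0 else MvPolynomial.monomial (v u) 1
    have phi_lift : ∀ u : M, phi K e m n (lift u) =
        ∑ w : W, if wt e m n u = w then Polynomial.X ^ (w : ℕ) else 0 := by
      intro u
      simp only [lift, map_sub, phi_monomial]
      split_ifs with hu
      · rw [Finset.sum_eq_single ⟨_, hu⟩]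
        · simp
        · intro w _ hw
          rw [if_neg]
          rintro h
          exact hw (Subtype.ext h.symm)
        · simp
      · rw [phi_monomial, hv' u u.2 hu, sub_self, Finset.sum_eq_zero]
        intro w _
        rw [if_neg]
        rintro h
        exact hu (h ▸ w.2)
    have hlift : ∑ u : M, c u • lift u ∈ definingIdeal K e m n := by
      refine (RingHom.mem_ker).2 ?_
      rw [map_sum]
      simp only [map_smul, phi_lift, Finset.smul_sum]
      rw [Finset.sum_comm]
      refine Finset.sum_eq_zero fun w _ => ?_
      have hw := congrFun (LinearMap.mem_ker.1 hc) w
      simp only [sums, LinearMap.pi_apply, LinearMap.sum_apply, Pi.zero_apply] at hw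
      refine Eq.trans ?_ (zero_smul K (Polynomial.X ^ (w : ℕ) : Polynomial K))
      rw [← hw, Finset.sum_smul]
      refine Finset.sum_congr rfl fun u _ => ?_
      split_ifs <;> simp
    have coeffs_lift : coeffs (∑ u : M, c u • lift u) = c := by
      ext u'
      simp only [coeffs, LinearMap.pi_apply, map_sum, map_smul, MvPolynomial.lcoeff_apply, lift,
        MvPolynomial.coeff_sub, MvPolynomial.coeff_monomial]
      rw [Finset.sum_eq_single u']
      · rw [if_pos rfl]
        split_ifs with h1
        · simp
        · rw [MvPolynomial.coeff_monomial, if_neg]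
          · simp
          · exact fun h => hv u' u'.2 h1 (by rw [h]; exact u'.2)
      · intro u _ hu
        rw [if_neg (fun h => hu (Subtype.ext h))]
        split_ifs with h1
        · simp
        · rw [MvPolynomial.coeff_monomial, if_neg]
          · simp
          · exact fun h => hv u u.2 h1 (h ▸ u'.2)
      · simp
    rw [← coeffs_lift]
    exact image_le _ hlift
  have h1 := Submodule.finrank_mono ker_le
  have h2 := LinearMap.finrank_range_add_finrank_ker sums
  have h3 := Submodule.finrank_le (LinearMap.range sums)
  have h4 : Module.finrank K (Submodule.span K (coeffs '' T)) ≤ T.ncard := by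
    refine (finrank_span_le_card (coeffs '' T)).trans ?_
    rw [← Set.ncard_eq_toFinset_card']
    exact Set.ncard_image_le hfin
  rw [Module.finrank_fintype_fun_eq_card, Fintype.card_coe] at h2 h3
  omega

end LowerBound

/-! ### The lower bound in numbers -/

section Count

variable {e m n : ℕ}

theorem mem_J {i : ℕ} : i ∈ J e m n ↔ i < e ∧ i ≠ m ∧ i ≠ n := by
  simp [J]

theorem card_J (hmn : m < n) (hn : n + 2 ≤ e) : (J e m n).card = e - 2 := by
  rw [J, Finset.card_sdiff_of_subset, Finset.card_range, Finset.card_pair hmn.ne]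
  intro i
  simp only [Finset.mem_insert, Finset.mem_singleton, Finset.mem_range]
  omega

theorem monomial_cases (s : J e m n →₀ ℕ) : s = 0 ∨ (∃ i, s = Finsupp.single i 1) ∨
    (∃ i j, s = Finsupp.single i 1 + Finsupp.single j 1) ∨ 3 * e ≤ wt e m n s := by
  induction s using finsupp_induction with
  | zero => exact Or.inl rfl
  | cons i s ih =>
    obtain rfl | ⟨j, rfl⟩ | ⟨j, k, rfl⟩ | h := ih
    · exact Or.inr (Or.inl ⟨i, add_zero _⟩)
    · exact Or.inr (Or.inr (Or.inl ⟨i, j, rfl⟩))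
    · refine Or.inr (Or.inr (Or.inr ?_))
      simp only [map_add, wt_single]
      omega
    · refine Or.inr (Or.inr (Or.inr ?_))
      simp only [map_add]
      omega

theorem isUnique_single (i : J e m n) : IsUnique (Finsupp.single i 1) := by
  intro s hs
  have hi := mem_J.1 i.2
  obtain rfl | ⟨j, rfl⟩ | ⟨j, k, rfl⟩ | h := monomial_cases s
  · simp only [wt_single, map_zero] at hs
    omega
  · simp only [wt_single] at hs
    rw [show j = i from Subtype.ext (by omega)]
  · simp only [wt_single, map_add] at hs
    omega
  · simp only [wt_single] at hs
    omega

theorem isUnique_pair (a b : J e m n) (hab : (a : ℕ) + b < e)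
    (h : ∀ c d : J e m n, (c : ℕ) + d = a + b → c = a ∨ c = b) :
    IsUnique (Finsupp.single a 1 + Finsupp.single b 1) := by
  intro s hs
  obtain rfl | ⟨j, rfl⟩ | ⟨j, k, rfl⟩ | h' := monomial_cases s
  · simp only [wt_single, map_add, map_zero] at hs
    omega
  · simp only [wt_single, map_add] at hs
    have := mem_J.1 j.2
    omega
  · simp only [wt_single, map_add] at hs
    obtain rfl | rfl := h j k (by omega)
    · rw [show k = b from Subtype.ext (by omega)]
    · rw [show k = a from Subtype.ext (by omega), add_comm]
  · simp only [wt_single, map_add] at hs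
    omega

theorem exists_pairs (hmn : m < n) (hn : n + 2 ≤ e) : ∃ P : Finset (J e m n →₀ ℕ),
    P.card = (e - 1).choose 2 ∧
    ∀ u ∈ P, ∃ i j, u = Finsupp.single i 1 + Finsupp.single j 1 := by
  classical
  refine ⟨Finset.univ.image fun z : Sym (J e m n) 2 => Multiset.toFinsupp z.1, ?_, ?_⟩
  · rw [Finset.card_image_of_injective, Finset.card_univ, Sym.card_sym_eq_choose, Fintype.card_coe,
      card_J hmn hn]
    · congr 1
      omega
    · intro z z' h
      exact Subtype.ext (Multiset.toFinsupp.injective h)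
  · intro u hu
    obtain ⟨z, -, rfl⟩ := Finset.mem_image.1 hu
    obtain ⟨a, b, hab⟩ := Multiset.card_eq_two.1 z.2
    refine ⟨a, b, ?_⟩
    rw [hab, Multiset.insert_eq_cons, ← Multiset.singleton_add, map_add,
      Multiset.toFinsupp_singleton, Multiset.toFinsupp_singleton]

/-- Here `M` consists of all quadratic monomials and the cubics in `E`. Weights from `3e` on need no
condition, since a cubic outside `E` also has that weight. For `(2, 3)` no quadratic monomial has
weight `2e + 3`, so one condition is saved. -/
theorem card_le_encard_of_extra {K : Type*} [Field K] (he : 10 ≤ e) (hm : 2 ≤ m) (hmn : m < n)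
    (hn : n + 2 ≤ e) (E : Finset (J e m n →₀ ℕ))
    (hE : ∀ u ∈ E, ∃ a b r : J e m n, u = Finsupp.single a 1 + (Finsupp.single a 1 +
      Finsupp.single b 1) ∧ 1 ≤ (a : ℕ) ∧ 1 ≤ (b : ℕ) ∧ (a : ℕ) + a + b = r ∧
      IsUnique (Finsupp.single a 1 + Finsupp.single a 1) ∧
      IsUnique (Finsupp.single a 1 + Finsupp.single b 1))
    (h23 : m = 2 → n = 3 → E = ∅)
    (T : Set (A K e m n)) (hT : Ideal.span T = definingIdeal K e m n) :
    (((e - 1).choose 2 + E.card - (e - if m = 2 ∧ n = 3 then 1 else 0) : ℕ) : ℕ∞) ≤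
      T.encard := by
  classical
  obtain ⟨P, hPcard, hP⟩ := exists_pairs hmn hn
  have h0 : 0 ∈ J e m n := mem_J.2 (by omega)
  have hE0 : ∀ u ∈ E, u ⟨0, h0⟩ = 0 := by
    intro u hu
    obtain ⟨a, b, r, rfl, ha, hb, -⟩ := hE u hu
    have ha' : a ≠ ⟨0, h0⟩ := by rintro rfl; simp at ha
    have hb' : b ≠ ⟨0, h0⟩ := by rintro rfl; simp at hb
    simp [ha', hb']
  have degP : ∀ u ∈ P, u.degree = 2 := by
    intro u hu
    obtain ⟨i, j, rfl⟩ := hP u hu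
    simp [map_add, Finsupp.degree_single]
  have degE : ∀ u ∈ E, u.degree = 3 := by
    intro u hu
    obtain ⟨a, b, r, rfl, -⟩ := hE u hu
    simp [map_add, Finsupp.degree_single]
  have hdisj : Disjoint P E := Finset.disjoint_left.2 fun u h1 h2 => by
    have := degP u h1
    have := degE u h2
    omega
  -- the other monomials of the same weights
  have hv : ∀ a b : J e m n, ∃ v ∉ P ∪ E, wt e m n v = 3 * e + a + b := by
    intro a b
    refine ⟨Finsupp.single ⟨0, h0⟩ 1 + (Finsupp.single a 1 + Finsupp.single b 1), ?_, ?_⟩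
    · rw [Finset.mem_union, not_or]
      constructor
      · intro h
        have := degP _ h
        simp [map_add, Finsupp.degree_single] at this
      · intro h
        have := hE0 _ h
        simp at this
    · simp only [map_add, wt_single]
      omega
  have hv' : ∀ i j : ℕ, i ∈ J e m n → j ∈ J e m n →
      ∃ v ∉ P ∪ E, wt e m n v = 3 * e + (i + j) := fun i j hi hj => by
    simpa [add_assoc] using hv ⟨i, hi⟩ ⟨j, hj⟩
  have hr : ∀ r : ℕ, r + 1 < e → ∃ v ∉ P ∪ E, wt e m n v = 3 * e + r := by
    intro r hre
    by_cases h1 : r ∈ J e m n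
    · simpa using hv' 0 r h0 h1
    by_cases h2 : r = m
    · have := hv' 1 (m - 1) (mem_J.2 (by omega)) (mem_J.2 (by omega))
      rwa [show 1 + (m - 1) = r by omega] at this
    obtain rfl : r = n := by
      rw [mem_J] at h1
      omega
    -- Here `r = n`. The splitting `1 + (n - 1)` fails when `n - 1 = m`, and `2 + (n - 2)` fails as
    -- well for `m = 2`; then the cube of `X_1` has the required weight.
    by_cases h3 : r = m + 1
    · by_cases h4 : m = 2
      · subst h4 h3
        have hJ : 1 ∈ J e 2 (2 + 1) := mem_J.2 (by omega)
        refine ⟨Finsupp.single ⟨1, hJ⟩ 1 + (Finsupp.single ⟨1, hJ⟩ 1 + Finsupp.single ⟨1, hJ⟩ 1),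
          ?_, ?_⟩
        · rw [h23 rfl rfl, Finset.union_empty]
          intro h
          have := degP _ h
          simp [map_add, Finsupp.degree_single] at this
        · simp only [map_add, wt_single]
          omega
      · have := hv' 2 (r - 2) (mem_J.2 (by omega)) (mem_J.2 (by omega))
        rwa [show 2 + (r - 2) = r by omega] at this
    · have := hv' 1 (r - 1) (mem_J.2 (by omega)) (mem_J.2 (by omega))
      rwa [show 1 + (r - 1) = r by omega] at this
  have main := card_le_encard_of_span_eq (K := K) (P ∪ E)
    (if m = 2 ∧ n = 3 then (Finset.Ico (2 * e) (3 * e)).erase (2 * e + 3)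
      else Finset.Ico (2 * e) (3 * e)) ?_ ?_ T hT
  · refine le_trans ?_ main
    rw [Nat.cast_le, Finset.card_union_of_disjoint hdisj, hPcard]
    refine Nat.sub_le_sub_left ?_ _
    split_ifs
    · rw [Finset.card_erase_of_mem (by rw [Finset.mem_Ico]; omega), Nat.card_Ico]
      omega
    · rw [Nat.card_Ico]
      omega
  · intro u hu i s hus
    obtain hu | hu := Finset.mem_union.1 hu
    · obtain ⟨j, k, rfl⟩ := hP u hu
      by_cases hij : i = j
      · subst hij
        rw [← add_left_cancel hus]
        exact isUnique_single k
      · have hik : i = k := by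
          by_contra hik
          have := DFunLike.congr_fun hus i
          simp [Ne.symm hij, Ne.symm hik] at this
          omega
        subst hik
        rw [add_comm] at hus
        rw [← add_left_cancel hus]
        exact isUnique_single j
    · obtain ⟨a, b, r, rfl, -, -, -, h1, h2⟩ := hE u hu
      by_cases hij : i = a
      · subst hij
        rw [← add_left_cancel hus]
        exact h2
      · have hik : i = b := by
          by_contra hik
          have := DFunLike.congr_fun hus i
          simp [Ne.symm hij, Ne.symm hik] at this
          omega
        subst hik
        rw [← add_assoc, add_comm] at hus
        rw [← add_left_cancel hus]
        exact h1
  · intro u hu huW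
    obtain hu | hu := Finset.mem_union.1 hu
    · obtain ⟨i, j, rfl⟩ := hP u hu
      have hi := mem_J.1 i.2
      have hj := mem_J.1 j.2
      simp only [map_add, wt_single] at huW ⊢
      obtain ⟨v, h1, h2⟩ := hr (i + j - e) (by omega)
      refine ⟨v, h1, ?_⟩
      have : e ≤ (i : ℕ) + j := by
        split_ifs at huW
        · rw [Finset.mem_erase, Finset.mem_Ico] at huW
          omega
        · rw [Finset.mem_Ico] at huW
          omega
      omega
    · obtain ⟨a, b, r, rfl, -, -, h1, -⟩ := hE u hu
      obtain ⟨v, h2, h3⟩ := hv ⟨0, h0⟩ r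
      refine ⟨v, h2, ?_⟩
      rw [h3]
      simp only [map_add, wt_single]
      omega

/-- The number of elements of a minimal generating set of the defining ideal. -/
def numGens (e m n : ℕ) : ℕ :=
  if (m = 2 ∧ n = 4) ∨ (m = 2 ∧ n = 5) ∨ (m = 3 ∧ n = 4) then (e - 2).choose 2
  else if m = 2 ∧ (n = 3 ∨ 6 ≤ n) then (e - 2).choose 2 - 1
  else (e - 2).choose 2 - 2

/-- The extra cubics are `X_1^3` for `m = 2`, `n ≥ 4`, also `X_1^2 X_{n-1}` if `n ≤ 5`, and `X_2^2
X_1`, `X_2^3` for `(3, 4)`. Their quadratic divisors have index sum `m` or `n` with no other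
decomposition. -/
theorem numGens_le_encard {K : Type*} [Field K] (he : 10 ≤ e) (hm : 2 ≤ m) (hmn : m < n)
    (hn : n + 2 ≤ e) (T : Set (A K e m n)) (hT : Ideal.span T = definingIdeal K e m n) :
    (numGens e m n : ℕ∞) ≤ T.encard := by
  classical
  have hchoose : (e - 1).choose 2 = (e - 2).choose 2 + (e - 2) := by
    obtain ⟨k, rfl⟩ : ∃ k, e = k + 2 := ⟨e - 2, by omega⟩
    simp only [Nat.add_sub_cancel, show k + 2 - 1 = k + 1 by omega]
    rw [Nat.choose_succ_succ' k 1, Nat.choose_one_right, add_comm]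
  by_cases h1 : m = 2 ∧ 4 ≤ n ∨ m = 3 ∧ n = 4
  swap
  · refine le_trans ?_ (card_le_encard_of_extra he hm hmn hn ∅ (by simp) (fun _ _ => rfl) T hT)
    rw [Nat.cast_le, numGens, hchoose, Finset.card_empty]
    split_ifs <;> omega
  have key : ∀ a b c : J e m n, (b ≠ c) → 1 ≤ (a : ℕ) → 1 ≤ (b : ℕ) → 1 ≤ (c : ℕ) →
      IsUnique (Finsupp.single a 1 + Finsupp.single a 1) →
      IsUnique (Finsupp.single a 1 + Finsupp.single b 1) →
      IsUnique (Finsupp.single a 1 + Finsupp.single c 1) →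
      (a : ℕ) + a + b ∈ J e m n → (a : ℕ) + a + c ∈ J e m n →
      (((e - 1).choose 2 + 2 - e : ℕ) : ℕ∞) ≤ T.encard := by
    intro a b c hbc ha hb hc haa hab hac h3 h4
    have := card_le_encard_of_extra he hm hmn hn
      {Finsupp.single a 1 + (Finsupp.single a 1 + Finsupp.single b 1),
       Finsupp.single a 1 + (Finsupp.single a 1 + Finsupp.single c 1)} ?_ (by omega) T hT
    · rw [Finset.card_pair, if_neg (by omega)] at this
      · exact this
      · intro h
        exact hbc (Finsupp.single_left_injective one_ne_zero
          (add_left_cancel (add_left_cancel h)))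
    · intro u hu
      rw [Finset.mem_insert, Finset.mem_singleton] at hu
      obtain rfl | rfl := hu
      · exact ⟨a, b, ⟨_, h3⟩, rfl, ha, hb, rfl, haa, hab⟩
      · exact ⟨a, c, ⟨_, h4⟩, rfl, ha, hc, rfl, haa, hac⟩
  have unique : ∀ (i j : ℕ) (hi : i ∈ J e m n) (hj : j ∈ J e m n), i + j < e →
      (∀ c d, c ∈ J e m n → d ∈ J e m n → c + d = i + j → c = i ∨ c = j) →
      IsUnique (Finsupp.single (⟨i, hi⟩ : J e m n) 1 + Finsupp.single ⟨j, hj⟩ 1) := by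
    intro i j hi hj h2 h3
    refine isUnique_pair _ _ h2 fun c d hcd => ?_
    simpa [Subtype.ext_iff] using h3 c d c.2 d.2 hcd
  obtain ⟨rfl, hn4⟩ | ⟨rfl, rfl⟩ := h1
  · have hJ1 : 1 ∈ J e 2 n := mem_J.2 (by omega)
    have h11 : IsUnique (Finsupp.single (⟨1, hJ1⟩ : J e 2 n) 1 + Finsupp.single ⟨1, hJ1⟩ 1) :=
      unique 1 1 hJ1 hJ1 (by omega) (by simp only [mem_J]; omega)
    by_cases hn5 : n ≤ 5
    · have hJ2 : n - 1 ∈ J e 2 n := mem_J.2 (by omega)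
      refine le_trans ?_ (key ⟨1, hJ1⟩ ⟨1, hJ1⟩ ⟨n - 1, hJ2⟩ ?_ ?_ ?_ ?_ ?_ ?_ ?_ ?_ ?_)
      · rw [Nat.cast_le, numGens, hchoose]
        split_ifs <;> omega
      · simp
        omega
      · simp
      · simp
      · simp only
        omega
      · exact h11
      · exact h11
      · exact unique _ _ _ _ (by omega) (by simp only [mem_J]; omega)
      · simp only [mem_J]; omega
      · simp only [mem_J]; omega
    · refine le_trans ?_ (card_le_encard_of_extra he hm hmn hn
        {Finsupp.single ⟨1, hJ1⟩ 1 + (Finsupp.single ⟨1, hJ1⟩ 1 + Finsupp.single ⟨1, hJ1⟩ 1)}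
        ?_ (by omega) T hT)
      · rw [Nat.cast_le, numGens, hchoose, Finset.card_singleton]
        split_ifs <;> omega
      · intro u hu
        rw [Finset.mem_singleton] at hu
        exact ⟨⟨1, hJ1⟩, ⟨1, hJ1⟩, ⟨3, mem_J.2 (by omega)⟩, hu, le_rfl, le_rfl, rfl, h11, h11⟩
  · have hJ1 : 1 ∈ J e 3 4 := mem_J.2 (by omega)
    have hJ2 : 2 ∈ J e 3 4 := mem_J.2 (by omega)
    have h22 : IsUnique (Finsupp.single (⟨2, hJ2⟩ : J e 3 4) 1 + Finsupp.single ⟨2, hJ2⟩ 1) :=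
      unique _ _ _ _ (by omega) (by simp only [mem_J]; omega)
    refine le_trans ?_ (key ⟨2, hJ2⟩ ⟨1, hJ1⟩ ⟨2, hJ2⟩ ?_ ?_ ?_ ?_ ?_ ?_ ?_ ?_ ?_)
    · rw [Nat.cast_le, numGens, hchoose]
      split_ifs <;> omega
    · simp
    · simp
    · simp
    · simp
    · exact h22
    · exact unique _ _ _ _ (by omega) (by simp only [mem_J]; omega)
    · exact h22
    · simp only [mem_J]; omega
    · simp only [mem_J]; omega

end Count

/-! ### The listed binomials lie in the kernel -/

section Kernel

variable {K : Type*} [Field K] {e m n : ℕ}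

theorem mul_sub_mul_mem {a b c d : ℤ} (ha : IsIdx e m n a) (hb : IsIdx e m n b)
    (hc : IsIdx e m n c) (hd : IsIdx e m n d) (h : a + b = c + d) :
    x K e m n a * x K e m n b - x K e m n c * x K e m n d ∈ definingIdeal K e m n := by
  refine (RingHom.mem_ker).2 ?_
  rw [map_sub, map_mul, map_mul, phi_x ha, phi_x hb, phi_x hc, phi_x hd, ← pow_add, ← pow_add,
    sub_eq_zero]
  congr 1
  unfold IsIdx at *
  omega

theorem mul_mul_sub_mul_mem {a b c d f : ℤ} (ha : IsIdx e m n a) (hb : IsIdx e m n b)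
    (hc : IsIdx e m n c) (hd : IsIdx e m n d) (hf : IsIdx e m n f) (h : a + b + c + e = d + f) :
    x K e m n a * x K e m n b * x K e m n c - x K e m n d * x K e m n f ∈
      definingIdeal K e m n := by
  refine (RingHom.mem_ker).2 ?_
  rw [map_sub, map_mul, map_mul, map_mul, phi_x ha, phi_x hb, phi_x hc, phi_x hd, phi_x hf,
    ← pow_add, ← pow_add, ← pow_add, sub_eq_zero]
  congr 1
  unfold IsIdx at *
  omega

theorem F1_subset {s : Set ℤ} (h : ∀ j ∈ s, IsIdx e m n j ∧ IsIdx e m n (j + 1)) :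
    F1 K e m n s ⊆ definingIdeal K e m n := by
  rintro _ ⟨j, hj, k, hk, -, rfl⟩
  exact mul_sub_mul_mem (h k hk).2 (h j hj).1 (h k hk).1 (h j hj).2 (by ring)

theorem F2_subset (h0 : IsIdx e m n 0) (h1 : IsIdx e m n (e - 1)) {s : Set ℤ}
    (h : ∀ j ∈ s, IsIdx e m n j ∧ IsIdx e m n (j + 1)) :
    F2 K e m n s ⊆ definingIdeal K e m n := by
  rintro _ ⟨j, hj, rfl⟩
  rw [f2, sq, ← mul_assoc]
  exact mul_mul_sub_mul_mem (h j hj).1 h0 h0 (h j hj).2 h1 (by ring)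

theorem F3_subset {s : Set ℤ} (h : ∀ j ∈ s, IsIdx e m n (m + 2) ∧ IsIdx e m n (m - 2) ∧
    IsIdx e m n (j - 4) ∧ IsIdx e m n j) : F3 K e m n s ⊆ definingIdeal K e m n := by
  rintro _ ⟨j, hj, rfl⟩
  obtain ⟨h1, h2, h3, h4⟩ := h j hj
  exact mul_sub_mul_mem h1 h3 h2 h4 (by ring)

theorem F4_subset {s : Set ℤ} (h : ∀ j ∈ s, IsIdx e m n (m - 1) ∧ IsIdx e m n (m + 1) ∧
    IsIdx e m n (j + 2) ∧ IsIdx e m n j) : F4 K e m n s ⊆ definingIdeal K e m n := by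
  rintro _ ⟨j, hj, rfl⟩
  obtain ⟨h1, h2, h3, h4⟩ := h j hj
  exact mul_sub_mul_mem h1 h3 h2 h4 (by ring)

theorem F5_subset {s : Set ℤ} (h : ∀ j ∈ s, IsIdx e m n (n - 1) ∧ IsIdx e m n (n + 1) ∧
    IsIdx e m n (j + 2) ∧ IsIdx e m n j) : F5 K e m n s ⊆ definingIdeal K e m n := by
  rintro _ ⟨j, hj, rfl⟩
  obtain ⟨h1, h2, h3, h4⟩ := h j hj
  exact mul_sub_mul_mem h1 h3 h2 h4 (by ring)

theorem f6_mem {j k : ℤ} (h : IsIdx e m n 0 ∧ IsIdx e m n j ∧ IsIdx e m n (m - 1) ∧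
    IsIdx e m n (m + 2 + k) ∧ IsIdx e m n (e - 3 + j - k)) :
    f6 K e m n j k ∈ definingIdeal K e m n :=
  mul_mul_sub_mul_mem h.1 h.2.1 h.2.2.1 h.2.2.2.1 h.2.2.2.2 (by ring)

theorem f7_mem {j k : ℤ} (h : IsIdx e m n 0 ∧ IsIdx e m n (1 + k) ∧ IsIdx e m n (n - 1 - k) ∧
    IsIdx e m n (n + 2 - j) ∧ IsIdx e m n (e - 2 + j)) :
    f7 K e m n j k ∈ definingIdeal K e m n :=
  mul_mul_sub_mul_mem h.1 h.2.1 h.2.2.1 h.2.2.2.1 h.2.2.2.2 (by ring)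

theorem f8_mem {j : ℤ} (h : IsIdx e m n 0 ∧ IsIdx e m n (n - 1) ∧
    IsIdx e m n (n + 2 - j) ∧ IsIdx e m n (e - 3 + j)) :
    f8 K e m n j ∈ definingIdeal K e m n := by
  rw [f8, sq]
  exact mul_mul_sub_mul_mem h.1 h.1 h.2.1 h.2.2.1 h.2.2.2 (by ring)

theorem f9_mem (h : IsIdx e m n (m - 1) ∧ IsIdx e m n (m - 4) ∧ IsIdx e m n (m + 2)) :
    f9 K e m n ∈ definingIdeal K e m n := by
  rw [f9, sq]
  exact mul_sub_mul_mem h.1 h.1 h.2.1 h.2.2 (by ring)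

theorem f10_mem (h : IsIdx e m n (m + 2) ∧ IsIdx e m n (e - 4) ∧ IsIdx e m n (m - 1) ∧
    IsIdx e m n (e - 1)) : f10 K e m n ∈ definingIdeal K e m n :=
  mul_sub_mul_mem h.1 h.2.1 h.2.2.1 h.2.2.2 (by ring)

theorem f11_mem (h : IsIdx e m n (m + 1) ∧ IsIdx e m n (n - 2) ∧ IsIdx e m n (m - 2) ∧
    IsIdx e m n (n + 1)) : f11 K e m n ∈ definingIdeal K e m n :=
  mul_sub_mul_mem h.1 h.2.1 h.2.2.1 h.2.2.2 (by ring)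

theorem f12_mem (h : IsIdx e m n (m + 2) ∧ IsIdx e m n (n - 1) ∧ IsIdx e m n (m - 1) ∧
    IsIdx e m n (n + 2)) : f12 K e m n ∈ definingIdeal K e m n :=
  mul_sub_mul_mem h.1 h.2.1 h.2.2.1 h.2.2.2 (by ring)

theorem f13a_mem (h : IsIdx e m n 1 ∧ IsIdx e m n 5 ∧ IsIdx e m n (e - 2)) :
    f13a K e m n ∈ definingIdeal K e m n := by
  rw [f13a, pow_succ, sq]
  exact mul_mul_sub_mul_mem h.1 h.1 h.1 h.2.1 h.2.2 (by ring)

theorem f13b_mem (h : IsIdx e m n 1 ∧ IsIdx e m n 4 ∧ IsIdx e m n (e - 1)) :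
    f13b K e m n ∈ definingIdeal K e m n := by
  rw [f13b, pow_succ, sq]
  exact mul_mul_sub_mul_mem h.1 h.1 h.1 h.2.1 h.2.2 (by ring)

theorem f14_mem (h : IsIdx e m n 1 ∧ IsIdx e m n (n - 1) ∧ IsIdx e m n (n + 2) ∧
    IsIdx e m n (e - 1)) : f14 K e m n ∈ definingIdeal K e m n := by
  rw [f14, sq]
  exact mul_mul_sub_mul_mem h.1 h.1 h.2.1 h.2.2.1 h.2.2.2 (by ring)

theorem f15_mem {j : ℤ} (h : IsIdx e m n 2 ∧ IsIdx e m n (j + 1) ∧ IsIdx e m n (6 + j) ∧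
    IsIdx e m n (e - 1)) : f15 K e m n j ∈ definingIdeal K e m n := by
  rw [f15, sq]
  exact mul_mul_sub_mul_mem h.1 h.1 h.2.1 h.2.2.1 h.2.2.2 (by ring)

open Set in
set_option maxHeartbeats 1600000 in
theorem gens_subset (he : 10 ≤ e) (hm : 2 ≤ m) (hmn : m < n) (hn : n + 2 ≤ e) :
    gens K e m n ⊆ definingIdeal K e m n := by
  unfold gens gensA gensB gensC gensD gensE gensF
  split_ifs
  all_goals
    simp only [union_subset_iff, insert_subset_iff, singleton_subset_iff, SetLike.mem_coe]
    repeat' apply And.intro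
  all_goals
    with_reducible first
    | refine F1_subset ?_
    | refine F2_subset ?_ ?_ ?_
    | refine F3_subset ?_
    | refine F4_subset ?_
    | refine F5_subset ?_
    | refine f6_mem ?_
    | refine f7_mem ?_
    | refine f8_mem ?_
    | refine f9_mem ?_
    | refine f10_mem ?_
    | refine f11_mem ?_
    | refine f12_mem ?_
    | refine f13a_mem ?_
    | refine f13b_mem ?_
    | refine f14_mem ?_
    | refine f15_mem ?_
  all_goals
    simp only [mem_sdiff, mem_union, mem_Icc, mem_insert_iff, mem_singleton_iff, IsIdx]
    omega

end Kernel

/-! ### Upper bound for the length of the list -/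

section Count

variable {K : Type*} [Field K] {e m n : ℕ}

theorem encard_union_le_add {α : Type*} {s t : Set α} {a b : ℕ} (hs : s.encard ≤ a)
    (ht : t.encard ≤ b) : (s ∪ t).encard ≤ (a + b : ℕ) := by
  push_cast
  exact (Set.encard_union_le s t).trans (add_le_add hs ht)

theorem encard_insert_le_add {α : Type*} {p : α} {t : Set α} {b : ℕ} (ht : t.encard ≤ b) :
    (insert p t).encard ≤ (b + 1 : ℕ) := by
  push_cast
  exact (Set.encard_insert_le t p).trans (by gcongr)

theorem encard_singleton_le_one {α : Type*} {p : α} : ({p} : Set α).encard ≤ (1 : ℕ) := by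
  simp

/-- Two gaps with their neighbours leave at most four runs of indices. Unused slots are filled with
the empty interval from `0` to `-1`. -/
theorem encard_le_of_subset_Icc {s : Set ℤ} (a₁ b₁ a₂ b₂ a₃ b₃ a₄ b₄ : ℤ) {k : ℕ}
    (h : ∀ j ∈ s, a₁ ≤ j ∧ j ≤ b₁ ∨ a₂ ≤ j ∧ j ≤ b₂ ∨ a₃ ≤ j ∧ j ≤ b₃ ∨ a₄ ≤ j ∧ j ≤ b₄)
    (hk : (b₁ + 1 - a₁).toNat + (b₂ + 1 - a₂).toNat + (b₃ + 1 - a₃).toNat + (b₄ + 1 - a₄).toNat ≤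
      k) : s.encard ≤ k := by
  have hsub : s ⊆ ((Finset.Icc a₁ b₁ ∪ Finset.Icc a₂ b₂ ∪ Finset.Icc a₃ b₃ ∪ Finset.Icc a₄ b₄ :
      Finset ℤ) : Set ℤ) := by
    intro j hj
    simp only [Finset.coe_union, Finset.coe_Icc, Set.mem_union, Set.mem_Icc]
    have := h j hj
    tauto
  refine (Set.encard_le_encard hsub).trans ?_
  rw [Set.encard_coe_eq_coe_finsetCard, Nat.cast_le]
  refine le_trans ?_ hk
  refine (Finset.card_union_le _ _).trans (add_le_add ((Finset.card_union_le _ _).trans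
    (add_le_add ((Finset.card_union_le _ _).trans (add_le_add ?_ ?_)) ?_)) ?_) <;>
  rw [Int.card_Icc]

theorem encard_F1_le {s : Set ℤ} {k : ℕ} (hs : s.encard ≤ k) :
    (F1 K e m n s).encard ≤ (k.choose 2 : ℕ) := by
  classical
  obtain ⟨S, rfl⟩ := (Set.finite_of_encard_le_coe hs).exists_finset_coe
  rw [Set.encard_coe_eq_coe_finsetCard, Nat.cast_le] at hs
  have hsub : F1 K e m n S ⊆ ((S.offDiag.image Sym2.mk.uncurry).image
      fun z : Sym2 ℤ => f1 K e m n z.sup z.inf : Finset (A K e m n)) := by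
    rintro _ ⟨j, hj, k, hk, hkj, rfl⟩
    refine Finset.mem_coe.2 (Finset.mem_image.2 ⟨s(j, k), Finset.mem_image.2
      ⟨(j, k), Finset.mem_offDiag.2 ⟨hj, hk, hkj.ne'⟩, rfl⟩, ?_⟩)
    simp [hkj.le]
  refine (Set.encard_le_encard hsub).trans ?_
  rw [Set.encard_coe_eq_coe_finsetCard, Nat.cast_le]
  refine Finset.card_image_le.trans ?_
  rw [Sym2.card_image_offDiag]
  exact Nat.choose_le_choose 2 hs

theorem encard_image_le_of_le {α β : Type*} {s : Set α} {f : α → β} {k : ℕ} (hs : s.encard ≤ k) :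
    (f '' s).encard ≤ k :=
  (Set.encard_image_le f s).trans hs

theorem encard_le_of_le {α : Type*} {s : Set α} {a b : ℕ} (h : s.encard ≤ a) (hab : a ≤ b) :
    s.encard ≤ b :=
  h.trans (Nat.cast_le.2 hab)

theorem encard_F2_le {s : Set ℤ} {k : ℕ} (hs : s.encard ≤ k) : (F2 K e m n s).encard ≤ k :=
  encard_image_le_of_le hs

theorem encard_F3_le {s : Set ℤ} {k : ℕ} (hs : s.encard ≤ k) : (F3 K e m n s).encard ≤ k :=
  encard_image_le_of_le hs

theorem encard_F4_le {s : Set ℤ} {k : ℕ} (hs : s.encard ≤ k) : (F4 K e m n s).encard ≤ k :=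
  encard_image_le_of_le hs

theorem encard_F5_le {s : Set ℤ} {k : ℕ} (hs : s.encard ≤ k) : (F5 K e m n s).encard ≤ k :=
  encard_image_le_of_le hs

theorem choose_two_sub_two (he : 10 ≤ e) : (e - 2).choose 2 = (e - 4).choose 2 + (e - 4) + (e - 3) ∧
    (e - 4).choose 2 = (e - 5).choose 2 + (e - 5) := by
  obtain ⟨k, rfl⟩ : ∃ k, e = k + 5 := ⟨e - 5, by omega⟩
  have h : ∀ l : ℕ, (l + 1).choose 2 = l.choose 2 + l := fun l => by
    rw [Nat.choose_succ_succ' l 1, Nat.choose_one_right, add_comm]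
  have h1 := h k
  have h2 := h (k + 1)
  have h3 := h (k + 1 + 1)
  simp only [show k + 5 - 2 = k + 1 + 1 + 1 by omega, show k + 5 - 3 = k + 1 + 1 by omega,
    show k + 5 - 4 = k + 1 by omega, show k + 5 - 5 = k by omega]
  omega

open Set in
set_option maxHeartbeats 1600000 in
theorem encard_gens_le_of_eq (he : 10 ≤ e) (hm : 2 ≤ m) (hmn : n = m + 1) (hn : n + 2 ≤ e) :
    (gens K e m n).encard ≤ (numGens e m n : ℕ) := by
  obtain ⟨c1, -⟩ := choose_two_sub_two he
  have hD : ∀ s : Set ℤ, (∀ j ∈ s, 0 ≤ j ∧ j ≤ e - 2 ∧ j ≠ m - 1 ∧ j ≠ m ∧ j ≠ n) →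
      s.encard ≤ (e - 4 : ℕ) := fun s hs =>
    encard_le_of_subset_Icc 0 (m - 2) (m + 2) (e - 2) 0 (-1) 0 (-1)
      (fun j hj => by have := hs j hj; omega) (by omega)
  have hF3 : ∃ k : ℕ, (4 ≤ m → k = m - 4 + (e - 6 - m)) ∧ (m < 4 → k = e - 6 - m) ∧
      ∀ s : Set ℤ, (∀ j ∈ s, 4 ≤ j ∧ j ≤ m - 1 ∨ m + 6 ≤ j ∧ j ≤ e - 1) → s.encard ≤ k :=
    ⟨m - 4 + (e - 6 - m), by omega, by omega, fun s hs =>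
      encard_le_of_subset_Icc 4 (m - 1) (m + 6) (e - 1) 0 (-1) 0 (-1)
        (fun j hj => by have := hs j hj; omega) (by omega)⟩
  obtain ⟨k3, hk3, hk3', hF3⟩ := hF3
  unfold gens gensA gensF
  split_ifs
  all_goals try omega
  all_goals
    apply encard_le_of_le
    · with_reducible repeat' first
      | exact encard_singleton_le_one
      | apply encard_insert_le_add
      | apply encard_union_le_add
      | refine encard_F1_le (hD _ ?_)
      | refine encard_F2_le (hD _ ?_)
      | refine encard_F3_le (hF3 _ ?_)
      all_goals
        simp only [mem_sdiff, mem_union, mem_Icc, mem_insert_iff, mem_singleton_iff]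
        omega
    · unfold numGens
      split_ifs <;> omega

open Set in
set_option maxHeartbeats 1600000 in
theorem encard_gens_le_of_add_two_le (he : 10 ≤ e) (hm : 2 ≤ m) (hmn : m + 2 ≤ n)
    (hn : n + 2 ≤ e) : (gens K e m n).encard ≤ (numGens e m n : ℕ) := by
  obtain ⟨c1, c2⟩ := choose_two_sub_two he
  have hD : ∀ s : Set ℤ, (∀ j ∈ s, 0 ≤ j ∧ j ≤ e - 2 ∧ j ≠ m - 1 ∧ j ≠ m ∧ j ≠ n - 1 ∧ j ≠ n) →
      s.encard ≤ (e - 5 : ℕ) := fun s hs =>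
    encard_le_of_subset_Icc 0 (m - 2) (m + 1) (n - 2) (n + 1) (e - 2) 0 (-1)
      (fun j hj => by have := hs j hj; omega) (by omega)
  -- The three interval lengths add up to `e - 8`. For `n = m + 2` or `n = e - 2` one interval has
  -- formal length `-1` but is empty, which each time adds `1`. The set for `f4` has the additional
  -- index `n - 1`.
  have hF45 : ∃ k : ℕ, k + 8 = e + (if n = m + 2 then 1 else 0) + (if n + 2 = e then 1 else 0) ∧
      (∀ s : Set ℤ, (∀ j ∈ s, 0 ≤ j ∧ j ≤ m - 3 ∨ m + 1 ≤ j ∧ j ≤ n - 3 ∨ j = n - 1 ∨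
        n + 1 ≤ j ∧ j ≤ e - 3) → s.encard ≤ (k + 1 : ℕ)) ∧
      (∀ s : Set ℤ, (∀ j ∈ s, 0 ≤ j ∧ j ≤ m - 3 ∨ m + 1 ≤ j ∧ j ≤ n - 3 ∨
        n + 1 ≤ j ∧ j ≤ e - 3) → s.encard ≤ k) := by
    refine ⟨e + (if n = m + 2 then 1 else 0) + (if n + 2 = e then 1 else 0) - 8, by omega,
      fun s hs => encard_le_of_subset_Icc 0 (m - 3) (m + 1) (n - 3) (n - 1) (n - 1) (n + 1) (e - 3)
        (fun j hj => by have := hs j hj; omega) ?_,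
      fun s hs => encard_le_of_subset_Icc 0 (m - 3) (m + 1) (n - 3) (n + 1) (e - 3) 0 (-1)
        (fun j hj => by have := hs j hj; omega) ?_⟩ <;>
    split_ifs <;> omega
  obtain ⟨k, hk, hF4, hF5⟩ := hF45
  unfold gens gensB gensC gensD gensE
  split_ifs
  all_goals try omega
  all_goals
    apply encard_le_of_le
    · with_reducible repeat' first
      | exact encard_singleton_le_one
      | apply encard_insert_le_add
      | apply encard_union_le_add
      | refine encard_F1_le (hD _ ?_)
      | refine encard_F2_le (hD _ ?_)
      | refine encard_F4_le (hF4 _ ?_)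
      | refine encard_F5_le (hF5 _ ?_)
      all_goals
        simp only [mem_sdiff, mem_union, mem_Icc, mem_insert_iff, mem_singleton_iff]
        omega
    · unfold numGens
      split_ifs at hk ⊢ <;> omega

theorem encard_gens_le (he : 10 ≤ e) (hm : 2 ≤ m) (hmn : m < n) (hn : n + 2 ≤ e) :
    (gens K e m n).encard ≤ (numGens e m n : ℕ) := by
  by_cases h : n = m + 1
  · exact encard_gens_le_of_eq he hm h hn
  · exact encard_gens_le_of_add_two_le he hm (by omega) hn

end Count

/-! ### The listed binomials yield the relations -/

section Members

variable {K : Type*} [Field K] {e m n : ℕ}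

theorem f1_mem_F1 {s : Set ℤ} {j k : ℤ} (hkj : k < j) (h : j ∈ s ∧ k ∈ s) :
    f1 K e m n j k ∈ F1 K e m n s :=
  ⟨j, h.1, k, h.2, hkj, rfl⟩

theorem f2_mem_F2 {s : Set ℤ} {j : ℤ} (h : j ∈ s) : f2 K e m n j ∈ F2 K e m n s :=
  ⟨j, h, rfl⟩

theorem f3_mem_F3 {s : Set ℤ} {j : ℤ} (h : j ∈ s) : f3 K e m n j ∈ F3 K e m n s :=
  ⟨j, h, rfl⟩

theorem f4_mem_F4 {s : Set ℤ} {j : ℤ} (h : j ∈ s) : f4 K e m n j ∈ F4 K e m n s :=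
  ⟨j, h, rfl⟩

theorem f5_mem_F5 {s : Set ℤ} {j : ℤ} (h : j ∈ s) : f5 K e m n j ∈ F5 K e m n s :=
  ⟨j, h, rfl⟩

open Set

theorem f1_mem_gens (he : 10 ≤ e) (hm : 2 ≤ m) (hmn : m < n) (hn : n + 2 ≤ e) {j k : ℤ}
    (hj : IsIdx e m n j) (hj' : IsIdx e m n (j + 1)) (hk : IsIdx e m n k)
    (hk' : IsIdx e m n (k + 1)) (hkj : k < j) : f1 K e m n j k ∈ gens K e m n := by
  unfold IsIdx at *
  unfold gens gensA gensB gensC gensD gensE gensF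
  split_ifs
  all_goals
    simp only [mem_union]
    with_reducible first
    | refine Or.inl (Or.inl (f1_mem_F1 hkj ?_))
    | refine Or.inl (Or.inl (Or.inl (f1_mem_F1 hkj ?_)))
    simp only [mem_sdiff, mem_Icc, mem_insert_iff, mem_singleton_iff]
    omega

theorem f2_mem_gens (he : 10 ≤ e) (hm : 2 ≤ m) (hmn : m < n) (hn : n + 2 ≤ e) {j : ℤ}
    (hj : IsIdx e m n j) (hj' : IsIdx e m n (j + 1)) : f2 K e m n j ∈ gens K e m n := by
  unfold IsIdx at *
  unfold gens gensA gensB gensC gensD gensE gensF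
  split_ifs
  all_goals
    simp only [mem_union]
    with_reducible first
    | refine Or.inl (Or.inr (f2_mem_F2 ?_))
    | refine Or.inl (Or.inl (Or.inr (f2_mem_F2 ?_)))
    simp only [mem_sdiff, mem_Icc, mem_insert_iff, mem_singleton_iff]
    omega

theorem f3_mem_gens (he : 10 ≤ e) (hm : 2 ≤ m) (hmn : n = m + 1) (hn : n + 2 ≤ e) {j : ℤ}
    (hj : 4 ≤ j ∧ j ≤ m - 1 ∨ m + 6 ≤ j ∧ j ≤ e - 1) : f3 K e m n j ∈ gens K e m n := by
  unfold gens gensA gensF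
  split_ifs
  all_goals try omega
  all_goals
    simp only [mem_union]
    refine Or.inr (Or.inl (f3_mem_F3 ?_))
    simp only [mem_union, mem_Icc]
    omega

theorem f4_mem_gens (he : 10 ≤ e) (hm : 2 ≤ m) (hmn : m + 2 ≤ n) (hn : n + 2 ≤ e) {j : ℤ}
    (hj : IsIdx e m n j) (hj' : IsIdx e m n (j + 2)) (hjm : j ≠ m - 1) :
    f4 K e m n j ∈ gens K e m n := by
  unfold IsIdx at *
  unfold gens gensB gensC gensD gensE
  split_ifs
  all_goals try omega
  all_goals
    simp only [mem_union]
    with_reducible first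
    | refine Or.inl (Or.inr (Or.inl (f4_mem_F4 ?_)))
    | refine Or.inr (Or.inl (Or.inl (f4_mem_F4 ?_)))
    simp only [mem_sdiff, mem_Icc, mem_insert_iff, mem_singleton_iff]
    omega

/-- The two excluded values cost nothing: `j = n - 1` gives zero, and `j = m - 1` gives the negative
of `f4` at `n - 1`. -/
theorem f5_mem_gens (he : 10 ≤ e) (hm : 2 ≤ m) (hmn : m + 2 ≤ n) (hn : n + 2 ≤ e) {j : ℤ}
    (hj : IsIdx e m n j) (hj' : IsIdx e m n (j + 2)) (hjm : j ≠ m - 1) (hjn : j ≠ n - 1) :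
    f5 K e m n j ∈ gens K e m n := by
  unfold IsIdx at *
  unfold gens gensB gensC gensD gensE
  split_ifs
  all_goals try omega
  all_goals
    simp only [mem_union]
    with_reducible first
    | refine Or.inl (Or.inr (Or.inr (f5_mem_F5 ?_)))
    | refine Or.inr (Or.inl (Or.inr (f5_mem_F5 ?_)))
    simp only [mem_union, mem_sdiff, mem_Icc, mem_insert_iff, mem_singleton_iff]
    omega

theorem f9_mem_gens (hm : 4 ≤ m) (hmn : n = m + 1) : f9 K e m n ∈ gens K e m n := by
  unfold gens gensA
  split_ifs
  all_goals try omega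
  all_goals simp only [mem_union, mem_insert_iff, mem_singleton_iff, true_or, or_true]

theorem f10_mem_gens (hmn : n = m + 1) (hme : m + 6 ≤ e) :
    f10 K e m n ∈ gens K e m n := by
  unfold gens gensA gensF
  split_ifs
  all_goals try omega
  all_goals simp only [mem_union, mem_insert_iff, mem_singleton_iff, true_or, or_true]

theorem f11_mem_gens (hmn : m + 3 ≤ n) (hn : n + 2 ≤ e) :
    f11 K e m n ∈ gens K e m n := by
  unfold gens gensC gensD gensE
  split_ifs
  all_goals try omega
  all_goals simp only [mem_union, mem_insert_iff, mem_singleton_iff, true_or, or_true]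

theorem f12_mem_gens (hmn : m + 3 ≤ n) (hn : n + 3 ≤ e) :
    f12 K e m n ∈ gens K e m n := by
  unfold gens gensC gensD gensE
  split_ifs
  all_goals try omega
  all_goals simp only [mem_union, mem_insert_iff, mem_singleton_iff, true_or, or_true]

theorem f13_mem_gens (hm : m = 2) :
    (n = 4 ∧ f13a K e m n ∈ gens K e m n) ∨ (n ≠ 4 ∧ f13b K e m n ∈ gens K e m n) := by
  by_cases h4 : n = 4
  · left
    refine ⟨h4, ?_⟩
    unfold gens gensD
    split_ifs
    all_goals try omega
    all_goals simp only [mem_union, mem_insert_iff, mem_singleton_iff, true_or, or_true]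
  · right
    refine ⟨h4, ?_⟩
    unfold gens gensD gensE gensF
    split_ifs
    all_goals try omega
    all_goals simp only [mem_union, mem_insert_iff, mem_singleton_iff, true_or, or_true]

theorem f14_mem_gens (hm : m = 2) (hn : n = 4 ∨ n = 5) : f14 K e m n ∈ gens K e m n := by
  unfold gens gensD
  split_ifs
  all_goals try omega
  all_goals simp only [mem_union, mem_insert_iff, mem_singleton_iff, or_true]

theorem f15_mem_gens (hm : m = 3) (hn : n = 4) :
    f15 K e m n 0 ∈ gens K e m n ∧ f15 K e m n 1 ∈ gens K e m n := by
  unfold gens gensF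
  split_ifs
  all_goals try omega
  all_goals simp only [mem_union, mem_insert_iff, mem_singleton_iff, true_or, or_true, and_self]

/-- For some pair of variables with index sum `e + r`, the difference of `X_0` times a product of
two variables with index sum `r` and of the product of the pair is in `gens`. -/
def Descends (K : Type*) [Field K] (e m n : ℕ) (r : ℤ) : Prop :=
  ∃ a b c d, IsIdx e m n a ∧ IsIdx e m n b ∧ IsIdx e m n c ∧ IsIdx e m n d ∧
    a + b = e + r ∧ c + d = r ∧
    x K e m n 0 * x K e m n c * x K e m n d - x K e m n a * x K e m n b ∈ gens K e m n

/-- The pair `a`, `b` excludes the lists without such a binomial: near the upper end of the range no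
two indices have sum `e + m - 1`. -/
theorem exists_f6_zero_mem_gens (he : 10 ≤ e) (hm : 2 ≤ m) (hmn : m < n) (hn : n + 2 ≤ e)
    {a b : ℤ} (ha : IsIdx e m n a) (hb : IsIdx e m n b) (hab : a + b = e + (m - 1)) :
    ∃ k, f6 K e m n 0 k ∈ gens K e m n ∧ IsIdx e m n (m + 2 + k) ∧
      IsIdx e m n (e - 3 + 0 - k) := by
  unfold IsIdx at *
  unfold gens gensA gensB gensC gensD gensE gensF
  split_ifs
  all_goals try omega
  all_goals
    simp only [mem_union, mem_insert_iff, mem_singleton_iff]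
    first
    | exact ⟨0, by simp only [true_or, or_true], by omega⟩
    | exact ⟨-1, by simp only [true_or, or_true], by omega⟩
    | exact ⟨1, by simp only [true_or, or_true], by omega⟩

theorem exists_f6_one_mem_gens (he : 10 ≤ e) (hm : 2 ≤ m) (hmn : m < n) (hn : n + 2 ≤ e)
    {a b : ℤ} (ha : IsIdx e m n a) (hb : IsIdx e m n b) (hab : a + b = e + m) :
    ∃ k, f6 K e m n 1 k ∈ gens K e m n ∧ IsIdx e m n (m + 2 + k) ∧
      IsIdx e m n (e - 3 + 1 - k) := by
  unfold IsIdx at *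
  unfold gens gensA gensB gensC gensD gensE gensF
  split_ifs
  all_goals try omega
  all_goals
    simp only [mem_union, mem_insert_iff, mem_singleton_iff]
    first
    | exact ⟨0, by simp only [true_or, or_true], by omega⟩
    | exact ⟨-1, by simp only [true_or, or_true], by omega⟩
    | exact ⟨1, by simp only [true_or, or_true], by omega⟩

theorem exists_f7_mem_gens (he : 10 ≤ e) (hm : 2 ≤ m) (hmn : m < n) (hn : n + 2 ≤ e)
    (h23 : ¬(m = 2 ∧ n = 3)) :
    ∃ j k, f7 K e m n j k ∈ gens K e m n ∧ IsIdx e m n (1 + k) ∧ IsIdx e m n (n - 1 - k) ∧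
      IsIdx e m n (n + 2 - j) ∧ IsIdx e m n (e - 2 + j) := by
  unfold IsIdx at *
  unfold gens gensA gensB gensC gensD gensE gensF
  split_ifs
  all_goals try omega
  all_goals
    simp only [mem_union, mem_insert_iff, mem_singleton_iff]
    first
    | exact ⟨0, 0, by simp only [true_or, or_true], by omega⟩
    | exact ⟨0, 1, by simp only [true_or, or_true], by omega⟩
    | exact ⟨1, 0, by simp only [true_or, or_true], by omega⟩
    | exact ⟨1, 1, by simp only [or_true], by omega⟩

theorem exists_f8_mem_gens (he : 10 ≤ e) (hm : 2 ≤ m) (hmn : m + 2 ≤ n) (hn : n + 2 ≤ e)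
    {a b : ℤ} (ha : IsIdx e m n a) (hb : IsIdx e m n b) (hab : a + b = e + (n - 1)) :
    ∃ j, f8 K e m n j ∈ gens K e m n ∧ IsIdx e m n (n + 2 - j) ∧
      IsIdx e m n (e - 3 + j) := by
  unfold IsIdx at *
  unfold gens gensB gensC gensD gensE
  split_ifs
  all_goals try omega
  all_goals
    simp only [mem_union, mem_insert_iff, mem_singleton_iff]
    first
    | exact ⟨0, by simp only [true_or, or_true], by omega⟩
    | exact ⟨1, by simp only [true_or, or_true], by omega⟩

theorem descends (he : 10 ≤ e) (hm : 2 ≤ m) (hmn : m < n) (hn : n + 2 ≤ e) {r : ℤ} (hr : 0 ≤ r)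
    (h23 : ¬(m = 2 ∧ n = 3 ∧ r = 3)) {a b : ℤ} (ha : IsIdx e m n a) (hb : IsIdx e m n b)
    (hab : a + b = e + r) : Descends K e m n r := by
  have h0 : IsIdx e m n 0 := by unfold IsIdx; omega
  by_cases h1 : r = m - 1
  · subst h1
    obtain ⟨k, hk, hk1, hk2⟩ := exists_f6_zero_mem_gens (K := K) he hm hmn hn ha hb hab
    exact ⟨_, _, _, _, hk1, hk2, h0, by unfold IsIdx; omega, by ring, by ring, hk⟩
  by_cases h2 : r = m
  · subst h2
    obtain ⟨k, hk, hk1, hk2⟩ := exists_f6_one_mem_gens (K := K) he hm hmn hn ha hb hab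
    exact ⟨_, _, _, _, hk1, hk2, by unfold IsIdx; omega, by unfold IsIdx; omega, by ring, by ring,
      hk⟩
  by_cases h3 : r = n
  · subst h3
    obtain ⟨j, k, hk, hk1, hk2, hk3, hk4⟩ := exists_f7_mem_gens (K := K) he hm hmn hn (by omega)
    exact ⟨_, _, _, _, hk3, hk4, hk1, hk2, by ring, by ring, hk⟩
  by_cases h4 : r = n - 1
  · subst h4
    obtain ⟨j, hk, hk1, hk2⟩ :=
      exists_f8_mem_gens (K := K) he hm (by omega) hn ha hb hab
    refine ⟨_, _, 0, n - 1, hk1, hk2, h0, by unfold IsIdx; omega, by ring, by ring, ?_⟩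
    rw [← sq]
    exact hk
  -- Away from the four special values both `r` and `r + 1` are indices, which is what `f2` needs.
  · have hr1 : IsIdx e m n r := by unfold IsIdx at *; omega
    have hr2 : IsIdx e m n (r + 1) := by unfold IsIdx at *; omega
    refine ⟨r + 1, e - 1, 0, r, hr2, by unfold IsIdx; omega, h0, hr1, by ring, by ring, ?_⟩
    rw [← sq, mul_comm]
    exact f2_mem_gens he hm hmn hn hr1 hr2

/-- The relations hold modulo `gens`. -/
theorem rels_gens (he : 10 ≤ e) (hm : 2 ≤ m) (hmn : m < n) (hn : n + 2 ≤ e) :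
    Rels e m n fun i => Ideal.Quotient.mk (Ideal.span (gens K e m n)) (x K e m n i) := by
  have rel : ∀ {p r : A K e m n}, p - r ∈ gens K e m n →
      Ideal.Quotient.mk (Ideal.span (gens K e m n)) p = Ideal.Quotient.mk _ r :=
    fun h => Ideal.Quotient.eq.2 (Ideal.subset_span h)
  constructor
  · intro j k hj hj' hk hk'
    simp only [← map_mul]
    obtain h | rfl | h := lt_trichotomy k j
    · exact rel (f1_mem_gens he hm hmn hn hj hj' hk hk' h)
    · rw [mul_comm]
    · have := rel (f1_mem_gens he hm hmn hn hk hk' hj hj' h)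
      rw [mul_comm, mul_comm (x K e m n k)]
      exact this.symm.trans (by rw [mul_comm])
  · intro h j hj
    simp only [← map_mul]
    exact rel (f3_mem_gens he hm h hn hj)
  · intro h h4
    simp only [← map_mul]
    have := f9_mem_gens (K := K) (e := e) h4 h
    rw [f9, sq] at this
    exact rel this
  · intro h h6
    simp only [← map_mul]
    exact rel (f10_mem_gens h h6)
  · intro h j hj hj' hjm
    simp only [← map_mul]
    exact rel (f4_mem_gens he hm h hn hj hj' hjm)
  · intro h j hj hj' hjm hjn
    simp only [← map_mul]
    exact rel (f5_mem_gens he hm h hn hj hj' hjm hjn)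
  · intro h
    simp only [← map_mul]
    exact rel (f11_mem_gens h hn)
  · intro h h'
    simp only [← map_mul]
    exact rel (f12_mem_gens h h')
  · rintro r hr h23 ⟨a, b, ha, hb, hab⟩
    obtain ⟨a', b', c, d, ha', hb', hc, hd, hs, ht, hmem⟩ :=
      descends (K := K) he hm hmn hn hr h23 ha hb hab
    refine ⟨a', b', c, d, ha', hb', hc, hd, hs, ht, ?_⟩
    simp only [← map_mul]
    exact rel hmem
  · intro h2
    obtain ⟨h4, h⟩ | ⟨h4, h⟩ := f13_mem_gens (K := K) (e := e) (n := n) h2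
    · rw [f13a, pow_succ, sq] at h
      refine ⟨5, e - 2, by unfold IsIdx; omega, by unfold IsIdx; omega, by ring, ?_⟩
      simp only [← map_mul]
      exact rel h
    · rw [f13b, pow_succ, sq] at h
      refine ⟨4, e - 1, by unfold IsIdx; omega, by unfold IsIdx; omega, by ring, ?_⟩
      simp only [← map_mul]
      exact rel h
  · intro h2 h45
    have h := f14_mem_gens (K := K) (e := e) h2 h45
    rw [f14, sq] at h
    simp only [← map_mul]
    exact rel h
  · intro h3 h4
    have h := (f15_mem_gens (K := K) (e := e) h3 h4).1
    rw [f15, sq] at h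
    simp only [← map_mul]
    exact rel h
  · intro h3 h4
    have h := (f15_mem_gens (K := K) (e := e) h3 h4).2
    rw [f15, sq] at h
    simp only [← map_mul]
    exact rel h

theorem span_gens (he : 10 ≤ e) (hm : 2 ≤ m) (hmn : m < n) (hn : n + 2 ≤ e) :
    Ideal.span (gens K e m n) = definingIdeal K e m n :=
  le_antisymm (Ideal.span_le.2 (gens_subset he hm hmn hn))
    (definingIdeal_le_span he hm hmn hn _ (rels_gens he hm hmn hn))

/-- The lower bound applied to the list itself forces its binomials to be pairwise distinct, so only
an upper count is needed. -/
theorem encard_gens (he : 10 ≤ e) (hm : 2 ≤ m) (hmn : m < n) (hn : n + 2 ≤ e) :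
    (gens K e m n).encard = (numGens e m n : ℕ) :=
  le_antisymm (encard_gens_le he hm hmn hn)
    (numGens_le_encard he hm hmn hn _ (span_gens he hm hmn hn))

end Members
end SallyType

theorem mainTheorem2 (K : Type*) [Field K] (e m n : ℕ)
    (he : 10 ≤ e) (hm : 2 ≤ m) (hmn : m < n) (hn : n ≤ e - 2) :
    Ideal.span (SallyType.gens K e m n) = SallyType.definingIdeal K e m n ∧
    (∀ T : Set (SallyType.A K e m n), T ⊂ SallyType.gens K e m n →
      Ideal.span T ≠ SallyType.definingIdeal K e m n) ∧
    (∀ T : Set (SallyType.A K e m n), Ideal.span T = SallyType.definingIdeal K e m n →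
      (SallyType.gens K e m n).encard ≤ T.encard) ∧
    (SallyType.gens K e m n).ncard =
      (if (m = 2 ∧ n = 4) ∨ (m = 2 ∧ n = 5) ∨ (m = 3 ∧ n = 4) then (e - 2).choose 2
      else if m = 2 ∧ (n = 3 ∨ 6 ≤ n) then (e - 2).choose 2 - 1
      else (e - 2).choose 2 - 2) := by
  have hn' : n + 2 ≤ e := by omega
  have hcard := SallyType.encard_gens (K := K) he hm hmn hn'
  have hmin : ∀ T : Set (SallyType.A K e m n), Ideal.span T = SallyType.definingIdeal K e m n →
      (SallyType.gens K e m n).encard ≤ T.encard := fun T hT =>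
    hcard.le.trans (SallyType.numGens_le_encard he hm hmn hn' T hT)
  refine ⟨SallyType.span_gens he hm hmn hn', fun T hT hspan => ?_, hmin, ?_⟩
  -- A proper subset of a finite set has strictly fewer elements, contrary to the lower bound.
  · have hfin : (SallyType.gens K e m n).Finite := Set.finite_of_encard_eq_coe hcard
    exact absurd (hmin T hspan) (not_le.2 ((hfin.subset hT.subset).encard_lt_encard hT))
  · rw [Set.ncard, hcard]
    rfl
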